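/- Let $\hbar,c>0$, let $\sigma_1,\sigma_2,\sigma_3$ be the Pauli matrices, $\gamma^0=\begin{pmatrix}0&1\\1&0\end{pmatrix}$, $\gamma^k=\begin{pmatrix}0&-\sigma_k\\\sigma_k&0\end{pmatrix}$, $\alpha^k=\gamma^0\gamma^k=\mathrm{diag}(\sigma_k,-\sigma_k)$. Let $T_0\subset M_4(\mathbb C)$ be the space of block-diagonal matrices $\mathrm{diag}(\psi_+,\psi_-)$ with $2\times2$ blocks satisfying $\operatorname{tr}\psi_+=\operatorname{tr}\psi_-=0$, and let $B\supset T_0$ be the space of all block-diagonal matrices. On smooth fields $\phi:\mathbb R^3\to M_4(\mathbb C)$ let $H\phi=-i\hbar c\sum_k\alpha^k\partial_k\phi$ (left multiplication by $\alpha^k$) and $P_j\phi=-i\hbar\,\partial_j\phi$. Put $\langle\phi|\zeta\rangle=\int_{\mathbb R^3}\operatorname{tr}(\phi^\dagger\zeta)\,d^3x$. For a subspace $D\subset C_c^\infty(\mathbb R^3;M_4(\mathbb C))$ let $\mathcal H_D$ be its completion in the $L^2$ norm (its closure in $L^2(\mathbb R^3;M_4(\mathbb C))$), and for $L=H$ or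 $L=P_j$ let $L_D$ be the operator in $\mathcal H_D$ with domain $D$ and matrix elements $\langle\phi|L\zeta\rangle$, i.e. $L_D\zeta$ is the orthogonal projection of $L\zeta$ onto $\mathcal H_D$ (so $L_D\zeta=L\zeta$ if $L\zeta\in D$). Then: 1. (Symmetry) $\langle\phi|H\zeta\rangle=\langle H\phi|\zeta\rangle$ for all $\phi,\zeta\in C_c^\infty(\mathbb R^3;T_0)$. 2. (Essential self-adjointness and spectrum) For each of $D=C_c^\infty(\mathbb R^3;T_0)$, $D=\{\phi\in C_c^\infty(\mathbb R^3;T_0): H\phi \text{ is } T_0\text{-valued}\}$ (transversal fields), and $D=C_c^\infty(\mathbb R^3;B)$, the operator $H_D$ is essentially self-adjoint in $\mathcal H_D$ and the spectrum of its closure is $\mathbb R$. In the last two cases $H$ maps $D$ into $D$, so that $H_D=H|_D$. 3. (Generalized eigenvalues) A number $E\in\mathbb C$ admits a non-zero bounded smooth $\phi:\mathbb R^3\to T_0$ with $H\phi=E\phi$ if and only if $E=\hbar c|k|$ or $E=-\hbar c|k|$ for some $k\in\mathbb R^3$. Moreover, for every $k\in\mathbb R^3$ and $E\in\mathbb C$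 there is a non-zero $A\in T_0$ with $H(e^{ik\cdot x}A)=E\,e^{ik\cdot x}A$ if and only if $E=\pm\hbar c|k|$. 4. (Commutation) $HP_j\phi=P_jH\phi$ for all smooth $\phi:\mathbb R^3\to M_4(\mathbb C)$ and $j=1,2,3$. For each of the three spaces $D$ above, $P_j$ maps $D$ into $D$, $(P_j)_D$ is essentially self-adjoint, and the self-adjoint closures of $H_D$ and $(P_j)_D$ commute (all their resolvents commute). 5. (Einstein relation $E=\hbar\omega$) For $\omega\in\mathbb R$ and smooth $\phi:\mathbb R^3\to M_4(\mathbb C)$, the field $e^{-i\omega t}\phi(x)$ solves $i\hbar\,\partial_t\Phi=H\Phi$ if and only if $H\phi=\hbar\omega\,\phi$. For $k\in\mathbb R^3$ there is a non-zero $A\in T_0$ such that $e^{i(k\cdot x-\omega t)}A$ is a solution if and only if $\omega^2=c^2|k|^2$. 6. (Einstein relation $p=\hbar k$) Let $p\in\mathbb C^3$. A non-zero bounded smooth $\phi:\mathbb R^3\to T_0$ satisfies $P_j\phi=p_j\phi$ for $j=1,2,3$ if and only if $p=\hbar k$ and $\phi=e^{ik\cdot x}A$ for some $k\in\mathbb R^3$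 and $A\in T_0$. For $E\in\mathbb C$, a non-zero bounded smooth $\phi:\mathbb R^3\to T_0$ with $H\phi=E\phi$ and $P_j\phi=p_j\phi$ for all $j$ exists if and only if $p=\hbar k$ and $E=\pm\hbar c|k|$ for some $k\in\mathbb R^3$. -/

import Mathlib

open MeasureTheory
open scoped Matrix ContDiff ENNReal

noncomputable section

namespace PhotonHamiltonian

/-- Physical space `ℝ³` (a constant-time slice) with its Euclidean structure. -/
abbrev Space : Type := EuclideanSpace ℝ (Fin 3)

/-- Complex `4 × 4` matrices, written in `2 × 2` blocks. -/
abbrev Mat : Type := Matrix (Fin 2 ⊕ Fin 2) (Fin 2 ⊕ Fin 2) ℂ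

/-- Rank-two bi-spinors: the space of complex `4 × 4` matrices with the norm and inner product
given by `⟨A|B⟩ = tr (A† B)`. -/
def BiSpinor : Type := Mat

instance : NormedAddCommGroup BiSpinor :=
  (Matrix.frobeniusNormedAddCommGroup : NormedAddCommGroup Mat)

instance : NormedSpace ℂ BiSpinor :=
  (Matrix.frobeniusNormedSpace : @NormedSpace ℂ Mat _
    Matrix.frobeniusNormedAddCommGroup.toSeminormedAddCommGroup)

/-- The underlying matrix of a bi-spinor. -/
def toMat : BiSpinor ≃ₗ[ℂ] Mat where
  toFun A := A
  invFun A := A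
  map_add' _ _ := rfl
  map_smul' _ _ := rfl
  left_inv _ := rfl
  right_inv _ := rfl

theorem frobenius_norm_sq (A : BiSpinor) :
    ‖A‖ ^ 2 = RCLike.re ((toMat A).conjTranspose * toMat A).trace := by
  have h : ‖A‖ = (∑ i, ∑ j, ‖toMat A i j‖ ^ (2 : ℝ)) ^ (1 / 2 : ℝ) :=
    Matrix.frobenius_norm_def (toMat A)
  rw [h, ← Real.sqrt_eq_rpow, Real.sq_sqrt (by positivity)]
  simp only [Matrix.trace, Matrix.diag, Matrix.mul_apply, Matrix.conjTranspose_apply, map_sum]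
  rw [Finset.sum_comm]
  refine Finset.sum_congr rfl fun i _ => Finset.sum_congr rfl fun j _ => ?_
  rw [Real.rpow_two, ← Complex.normSq_eq_norm_sq]
  simp [Complex.normSq_apply]

instance : InnerProductSpace ℂ BiSpinor where
  inner A B := ((toMat A).conjTranspose * toMat B).trace
  norm_sq_eq_re_inner A := frobenius_norm_sq A
  conj_inner_symm A B := by
    rw [starRingEnd_apply, ← Matrix.trace_conjTranspose]
    simp
  add_left A B C := by simp [Matrix.add_mul]
  smul_left A B r := by simp

instance : FiniteDimensional ℂ BiSpinor := Module.Finite.equiv toMat.symm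

instance : FiniteDimensional ℝ BiSpinor := FiniteDimensional.complexToReal BiSpinor

instance : CompleteSpace BiSpinor := FiniteDimensional.complete ℂ BiSpinor

/-- Multiplication of a bi-spinor by a matrix from the left. -/
def leftMul (M : Mat) : BiSpinor →L[ℂ] BiSpinor :=
  LinearMap.toContinuousLinearMap
    (toMat.symm.toLinearMap ∘ₗ LinearMap.mulLeft ℂ M ∘ₗ toMat.toLinearMap)

theorem toMat_leftMul (M : Mat) (A : BiSpinor) : toMat (leftMul M A) = M * toMat A := rfl

/-! ### Dirac matrices in the Weyl representation -/

def pauli : Fin 3 → Matrix (Fin 2) (Fin 2) ℂ :=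
  ![!![0, 1; 1, 0], !![0, -Complex.I; Complex.I, 0], !![1, 0; 0, -1]]

def gammaTime : Mat := Matrix.fromBlocks 0 1 1 0

def gammaSpace (k : Fin 3) : Mat := Matrix.fromBlocks 0 (-pauli k) (pauli k) 0

/-- `α^k = γ⁰ γ^k`. -/
def alpha (k : Fin 3) : Mat := gammaTime * gammaSpace k

theorem alpha_eq (k : Fin 3) : alpha k = Matrix.fromBlocks (pauli k) 0 0 (-pauli k) := by
  simp [alpha, gammaTime, gammaSpace, Matrix.fromBlocks_multiply]

/-- Block-diagonal matrices. -/
def BlockDiagMat : Submodule ℂ Mat where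
  carrier := {A | A.toBlocks₁₂ = 0 ∧ A.toBlocks₂₁ = 0}
  add_mem' {A B} hA hB := by
    have h1 : (A + B).toBlocks₁₂ = A.toBlocks₁₂ + B.toBlocks₁₂ := rfl
    have h2 : (A + B).toBlocks₂₁ = A.toBlocks₂₁ + B.toBlocks₂₁ := rfl
    exact ⟨by rw [h1, hA.1, hB.1, add_zero], by rw [h2, hA.2, hB.2, add_zero]⟩
  zero_mem' := ⟨rfl, rfl⟩
  smul_mem' r A hA := by
    have h1 : (r • A).toBlocks₁₂ = r • A.toBlocks₁₂ := rfl
    have h2 : (r • A).toBlocks₂₁ = r • A.toBlocks₂₁ := rfl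
    exact ⟨by rw [h1, hA.1, smul_zero], by rw [h2, hA.2, smul_zero]⟩

/-- Block-diagonal matrices `diag(ψ₊, ψ₋)` with `tr ψ₊ = tr ψ₋ = 0`. -/
def TZeroMat : Submodule ℂ Mat where
  carrier := {A | A ∈ BlockDiagMat ∧ A.toBlocks₁₁.trace = 0 ∧ A.toBlocks₂₂.trace = 0}
  add_mem' {A B} hA hB := by
    refine ⟨BlockDiagMat.add_mem hA.1 hB.1, ?_, ?_⟩
    · have : (A + B).toBlocks₁₁ = A.toBlocks₁₁ + B.toBlocks₁₁ := rfl
      rw [this, Matrix.trace_add, hA.2.1, hB.2.1, add_zero]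
    · have : (A + B).toBlocks₂₂ = A.toBlocks₂₂ + B.toBlocks₂₂ := rfl
      rw [this, Matrix.trace_add, hA.2.2, hB.2.2, add_zero]
  zero_mem' := ⟨BlockDiagMat.zero_mem, Matrix.trace_zero _ _, Matrix.trace_zero _ _⟩
  smul_mem' r A hA := by
    refine ⟨BlockDiagMat.smul_mem r hA.1, ?_, ?_⟩
    · have : (r • A).toBlocks₁₁ = r • A.toBlocks₁₁ := rfl
      rw [this, Matrix.trace_smul, hA.2.1, smul_zero]
    · have : (r • A).toBlocks₂₂ = r • A.toBlocks₂₂ := rfl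
      rw [this, Matrix.trace_smul, hA.2.2, smul_zero]

/-- Block-diagonal bi-spinors. -/
def BlockDiag : Submodule ℂ BiSpinor := BlockDiagMat.comap toMat.toLinearMap

/-- The fibre `T₀`: block-diagonal bi-spinors whose two diagonal blocks are trace-free. -/
def TZero : Submodule ℂ BiSpinor := TZeroMat.comap toMat.toLinearMap

/-! ### Differential expressions -/

/-- `∂_k φ`. -/
def partialD (k : Fin 3) (φ : Space → BiSpinor) : Space → BiSpinor :=
  fun x => fderiv ℝ φ x (EuclideanSpace.single k 1)

/-- The diagonal Hamiltonian `H = -iħc α^k ∂_k`, as a differential expression. -/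
def hamiltonian (ħ c : ℝ) (φ : Space → BiSpinor) : Space → BiSpinor :=
  fun x => (-(Complex.I * ħ * c)) • ∑ k, leftMul (alpha k) (partialD k φ x)

/-- The components `-iħ ∂_j` of the momentum operator, as differential expressions. -/
def momentum (ħ : ℝ) (j : Fin 3) (φ : Space → BiSpinor) : Space → BiSpinor :=
  fun x => (-(Complex.I * ħ)) • partialD j φ x

/-! ### Test fields -/

/-- `C_c^∞(ℝ³; M₄(ℂ))`. -/
def TestFields : Submodule ℂ (Space → BiSpinor) where
  carrier := {φ | ContDiff ℝ ∞ φ ∧ HasCompactSupport φ}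
  add_mem' hφ hψ := ⟨hφ.1.add hψ.1, hφ.2.add hψ.2⟩
  zero_mem' := ⟨contDiff_const, HasCompactSupport.zero⟩
  smul_mem' r _ hφ := ⟨contDiff_const.smul hφ.1, hφ.2.smul_left (f := fun _ => r)⟩

theorem testFields_differentiable (φ : TestFields) : Differentiable ℝ φ.1 :=
  φ.2.1.differentiable (by simp)

theorem partialD_mem (k : Fin 3) (φ : TestFields) : partialD k φ.1 ∈ TestFields :=
  ⟨(φ.2.1.fderiv_right (m := ∞) (by simp)).clm_apply contDiff_const,
    φ.2.2.fderiv_apply (𝕜 := ℝ) _⟩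

/-- `∂_k` on test fields. -/
def partialT (k : Fin 3) : TestFields →ₗ[ℂ] TestFields where
  toFun φ := ⟨partialD k φ.1, partialD_mem k φ⟩
  map_add' φ ψ := by
    ext1; funext x
    change fderiv ℝ (φ.1 + ψ.1) x _ = fderiv ℝ φ.1 x _ + fderiv ℝ ψ.1 x _
    rw [fderiv_add (testFields_differentiable φ x) (testFields_differentiable ψ x)]
    rfl
  map_smul' r φ := by
    ext1; funext x
    change fderiv ℝ (r • φ.1) x _ = r • fderiv ℝ φ.1 x _
    rw [fderiv_const_smul (testFields_differentiable φ x)]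
    rfl

/-- Left multiplication by a constant matrix on test fields. -/
def mulLeftT (M : Mat) : TestFields →ₗ[ℂ] TestFields where
  toFun φ := ⟨fun x => leftMul M (φ.1 x),
    ((leftMul M).restrictScalars ℝ).contDiff.comp φ.2.1,
    φ.2.2.comp_left (g := leftMul M) (map_zero _)⟩
  map_add' φ ψ := by ext1; funext x; exact map_add (leftMul M) _ _
  map_smul' r φ := by ext1; funext x; exact map_smul (leftMul M) _ _

/-- `H` as a linear map of test fields. -/
def hamiltonianT (ħ c : ℝ) : TestFields →ₗ[ℂ] TestFields :=
  (-(Complex.I * ħ * c)) • ∑ k, mulLeftT (alpha k) ∘ₗ partialT k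

/-- `-iħ ∂_j` as a linear map of test fields. -/
def momentumT (ħ : ℝ) (j : Fin 3) : TestFields →ₗ[ℂ] TestFields :=
  (-(Complex.I * ħ)) • partialT j

theorem hamiltonianT_coe (ħ c : ℝ) (φ : TestFields) :
    (hamiltonianT ħ c φ : Space → BiSpinor) = hamiltonian ħ c φ := by
  funext x
  simp [hamiltonianT, hamiltonian, mulLeftT, partialT]

theorem momentumT_coe (ħ : ℝ) (j : Fin 3) (φ : TestFields) :
    (momentumT ħ j φ : Space → BiSpinor) = momentum ħ j φ := rfl

/-- Test fields with values in a given fibre. -/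
def fieldsIn (V : Submodule ℂ BiSpinor) : Submodule ℂ TestFields where
  carrier := {φ | ∀ x, φ.1 x ∈ V}
  add_mem' hφ hψ x := V.add_mem (hφ x) (hψ x)
  zero_mem' _ := V.zero_mem
  smul_mem' r _ hφ x := V.smul_mem r (hφ x)

/-- `C_c^∞(ℝ³; T₀)`. -/
def TZeroFields : Submodule ℂ TestFields := fieldsIn TZero

/-- Block-diagonal test fields, without the trace condition. -/
def BlockDiagFields : Submodule ℂ TestFields := fieldsIn BlockDiag

/-- The transversal fields: those `φ ∈ C_c^∞(ℝ³; T₀)` for which `H φ` is again `T₀`-valued. -/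
def TransversalFields (ħ c : ℝ) : Submodule ℂ TestFields :=
  TZeroFields ⊓ TZeroFields.comap (hamiltonianT ħ c)

/-! ### Hilbert spaces and operators -/

/-- `L²(ℝ³; M₄(ℂ))` with inner product `∫ tr(φ† ζ)`. -/
abbrev L2Fields : Type := Lp BiSpinor 2 (volume : Measure Space)

theorem testFields_memLp (φ : TestFields) : MemLp φ.1 2 (volume : Measure Space) :=
  φ.2.1.continuous.memLp_of_hasCompactSupport φ.2.2

/-- The class of a test field in `L²`. -/
def toL2 : TestFields →ₗ[ℂ] L2Fields where
  toFun φ := (testFields_memLp φ).toLp φ.1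
  map_add' φ ψ := MemLp.toLp_add (testFields_memLp φ) (testFields_memLp ψ)
  map_smul' r φ := MemLp.toLp_const_smul r (testFields_memLp φ)

theorem toL2_injective : Function.Injective toL2 := by
  intro φ ψ h
  have h' := (MemLp.toLp_eq_toLp_iff (testFields_memLp φ) (testFields_memLp ψ)).1 h
  exact Subtype.ext ((φ.2.1.continuous.ae_eq_iff_eq volume ψ.2.1.continuous).1 h')

theorem inner_toL2 (φ ψ : TestFields) :
    inner ℂ (toL2 φ) (toL2 ψ) = ∫ x, ((toMat (φ.1 x)).conjTranspose * toMat (ψ.1 x)).trace := by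
  rw [L2.inner_def]
  refine integral_congr_ae ?_
  filter_upwards [(testFields_memLp φ).coeFn_toLp, (testFields_memLp ψ).coeFn_toLp] with x h1 h2
  change inner ℂ (((testFields_memLp φ).toLp φ.1 : L2Fields) x) (((testFields_memLp ψ).toLp ψ.1 : L2Fields) x) = _
  rw [h1, h2]
  rfl

/-- The completion of a space `D` of test fields in the `L²` norm, realized as the closure of
`D` in `L²(ℝ³; M₄(ℂ))`. -/
def completion (D : Submodule ℂ TestFields) : Submodule ℂ L2Fields :=
  (D.map toL2).topologicalClosure

instance (D : Submodule ℂ TestFields) : CompleteSpace (completion D) :=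
  inferInstanceAs (CompleteSpace (D.map toL2).topologicalClosure)

/-- The inclusion of `D` in its completion. -/
def toCompletion (D : Submodule ℂ TestFields) : D →ₗ[ℂ] completion D where
  toFun φ := ⟨toL2 φ.1, (D.map toL2).le_topologicalClosure (Submodule.mem_map_of_mem φ.2)⟩
  map_add' φ ψ := Subtype.ext (toL2.map_add φ.1 ψ.1)
  map_smul' r φ := Subtype.ext (toL2.map_smul r φ.1)

theorem toCompletion_injective (D : Submodule ℂ TestFields) :
    Function.Injective (toCompletion D) := fun _ _ h =>
  Subtype.ext (toL2_injective (congrArg Subtype.val h))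

/-- The operator in the Hilbert space `completion D`, with domain `D`, whose matrix elements are
`⟨φ | L ζ⟩`: it sends `ζ ∈ D` to the unique `η ∈ completion D` with `⟨φ | η⟩ = ⟨φ | L ζ⟩` for
all `φ`, that is to the orthogonal projection of `L ζ`. It sends `ζ` to `L ζ` itself
whenever `L ζ ∈ D`. -/
def inducedOperator (D : Submodule ℂ TestFields) (L : TestFields →ₗ[ℂ] TestFields) :
    completion D →ₗ.[ℂ] completion D where
  domain := LinearMap.range (toCompletion D)
  toFun := (completion D).orthogonalProjectionOnto.toLinearMap ∘ₗ toL2 ∘ₗ L ∘ₗ D.subtype ∘ₗ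
    (LinearEquiv.ofInjective (toCompletion D) (toCompletion_injective D)).symm.toLinearMap

theorem inducedOperator_apply (D : Submodule ℂ TestFields) (L : TestFields →ₗ[ℂ] TestFields)
    (φ : D) (hφ : L φ.1 ∈ D) :
    inducedOperator D L ⟨toCompletion D φ, LinearMap.mem_range_self _ φ⟩ =
      toCompletion D ⟨L φ.1, hφ⟩ := by
  have h : (LinearEquiv.ofInjective (toCompletion D) (toCompletion_injective D)).symm
      ⟨toCompletion D φ, LinearMap.mem_range_self _ φ⟩ = φ := by
    rw [LinearEquiv.symm_apply_eq]
    rfl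
  change (completion D).orthogonalProjectionOnto (toL2 (L (D.subtype
    ((LinearEquiv.ofInjective (toCompletion D) (toCompletion_injective D)).symm
      ⟨toCompletion D φ, LinearMap.mem_range_self _ φ⟩)))) = _
  rw [h]
  exact Submodule.orthogonalProjectionOnto_mem_subspace_eq_self (toCompletion D ⟨L φ.1, hφ⟩)

theorem inner_inducedOperator (D : Submodule ℂ TestFields) (L : TestFields →ₗ[ℂ] TestFields)
    (φ ζ : D) :
    inner ℂ (toCompletion D φ)
      (inducedOperator D L ⟨toCompletion D ζ, LinearMap.mem_range_self _ ζ⟩) =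
      ∫ x, ((toMat (φ.1.1 x)).conjTranspose * toMat ((L ζ.1).1 x)).trace := by
  have h : (LinearEquiv.ofInjective (toCompletion D) (toCompletion_injective D)).symm
      ⟨toCompletion D ζ, LinearMap.mem_range_self _ ζ⟩ = ζ := by
    rw [LinearEquiv.symm_apply_eq]
    rfl
  change inner ℂ (toCompletion D φ) ((completion D).orthogonalProjectionOnto (toL2 (L (D.subtype
    ((LinearEquiv.ofInjective (toCompletion D) (toCompletion_injective D)).symm
      ⟨toCompletion D ζ, LinearMap.mem_range_self _ ζ⟩))))) = _
  rw [h, Submodule.inner_orthogonalProjectionOnto_eq_of_mem_left]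
  exact inner_toL2 φ.1 (L ζ.1)

section Operators

variable {E : Type*} [NormedAddCommGroup E] [InnerProductSpace ℂ E] [CompleteSpace E]

/-- Densely defined and closable, with self-adjoint closure. -/
def IsEssentiallySelfAdjoint (T : E →ₗ.[ℂ] E) : Prop :=
  Dense (T.domain : Set E) ∧ T.IsClosable ∧ IsSelfAdjoint T.closure

/-- `R` is the bounded two-sided inverse of `T - z`. -/
def IsResolventAt (T : E →ₗ.[ℂ] E) (z : ℂ) (R : E →L[ℂ] E) : Prop :=
  (∀ x : E, ∃ h : R x ∈ T.domain, T ⟨R x, h⟩ - z • R x = x) ∧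
    ∀ x : T.domain, R (T x - z • (x : E)) = x

/-- The spectrum of an unbounded operator. -/
def spectrumOf (T : E →ₗ.[ℂ] E) : Set ℂ := {z | ¬ ∃ R : E →L[ℂ] E, IsResolventAt T z R}

/-- (Strong) commutation of self-adjoint operators: all their resolvents commute. -/
def StronglyCommute (S T : E →ₗ.[ℂ] E) : Prop :=
  ∀ (z w : ℂ) (R Q : E →L[ℂ] E), IsResolventAt S z R → IsResolventAt T w Q → Commute R Q

end Operators

/-- Essential self-adjointness with spectrum `ℝ` of the operator induced by `H` on `D`. -/
def HasSelfAdjointHamiltonian (ħ c : ℝ) (D : Submodule ℂ TestFields) : Prop :=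
  IsEssentiallySelfAdjoint (inducedOperator D (hamiltonianT ħ c)) ∧
    spectrumOf (inducedOperator D (hamiltonianT ħ c)).closure = Set.range ((↑) : ℝ → ℂ)

/-- The components of the momentum operator on `D` are essentially self-adjoint and their
closures commute with the closure of the operator induced by `H`. -/
def CommutesWithMomentum (ħ c : ℝ) (D : Submodule ℂ TestFields) : Prop :=
  ∀ j : Fin 3, (∀ φ ∈ D, momentumT ħ j φ ∈ D) ∧
    IsEssentiallySelfAdjoint (inducedOperator D (momentumT ħ j)) ∧
    StronglyCommute (inducedOperator D (hamiltonianT ħ c)).closure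
      (inducedOperator D (momentumT ħ j)).closure

/-! ### Generalized eigenfunctions, plane waves, time evolution -/

/-- A non-zero bounded smooth `T₀`-valued field, the kind of field used as generalized
eigenfunction. -/
def IsGeneralizedState (φ : Space → BiSpinor) : Prop :=
  ContDiff ℝ ∞ φ ∧ (∃ C : ℝ, ∀ x, ‖φ x‖ ≤ C) ∧ (∀ x, φ x ∈ TZero) ∧ φ ≠ 0

/-- `e^{i k·x} A`. -/
def planeWave (k : Space) (A : BiSpinor) : Space → BiSpinor :=
  fun x => Complex.exp (Complex.I * (inner ℝ k x : ℝ)) • A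

/-- The time-harmonic field `e^{-i freq t} φ(x)`. -/
def harmonic (freq : ℝ) (φ : Space → BiSpinor) : ℝ → Space → BiSpinor :=
  fun t x => Complex.exp (-(Complex.I * freq * t)) • φ x

/-- `iħ ∂_t Φ = H Φ`, for fields that are smooth in space. -/
def SolvesSchrodinger (ħ c : ℝ) (Φ : ℝ → Space → BiSpinor) : Prop :=
  (∀ t, ContDiff ℝ ∞ (Φ t)) ∧ ∀ t x, ∃ Φ' : BiSpinor,
    HasDerivAt (fun s => Φ s x) Φ' t ∧ (Complex.I * ħ) • Φ' = hamiltonian ħ c (Φ t) x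

end PhotonHamiltonian

end

/-! The Fourier transform turns everything into linear algebra on the fibre. With the kernel
`e^{-2πi k·x}`, `H` becomes multiplication by the Hermitian matrix `2πħc α·k`, and `P_j` becomes
multiplication by the real number `2πħ k_j`. Two facts about the fibre carry the proof: `(α·k)² =
|k|²` (`diracSymbol_diracSymbol`), and `α·k` sends block-scalar matrices, the complement of `T₀` in
`B`, into `T₀` (`diracSymbol_mem_tZero`).

`H` need not preserve `T₀`-valued fields, but `H_D` depends only on the matrix elements of `H` on
`D`. Hence `H` may be replaced by its compression `compressedT`, with symbol `P_V (2πħc α·k) P_V`,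
where `P_V` is the orthogonal projection onto the fibre `V`. The compression maps each of the three
domains into itself and commutes with `P_j`.

Essential self-adjointness and strong commutation both come from one density statement, the last
field of `IsCommutingPair`: for non-real `z`, `w`, the vectors `(S - z)(P - w)φ` are dense. Indeed
both `S - z` and `P - w` then have dense range, and the two products of resolvents agree on a dense
set. The density holds because translates of test fields detect Fourier transforms almost everywhere
(`ae_forall_inner_symbol_eq_zero`): a vector orthogonal to the range satisfies, at almost every `k`,
an eigenvalue equation for a Hermitian matrix with a non-real eigenvalue.

The spectrum is all of `ℝ` because slowly modulated plane waves, made transversal by one application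
of the compression, are approximate eigenvectors at every non-zero real number
(`exists_approximate_eigenvector`).

A bounded eigenfunction has a real eigenvalue by a Caccioppoli inequality (`exists_caccioppoli`):
iterated twice, it beats the volume growth `r³`. Plane waves with helicity amplitudes realize every
real value, and momentum eigenfunctions are found by solving a linear differential equation along
rays. -/

namespace PhotonHamiltonian

/-! ### Resolvents, essential self-adjointness and strong commutation of abstract unbounded
operators. -/

section Operators

variable {E : Type*} [NormedAddCommGroup E] [InnerProductSpace ℂ E]

/-- Only `-z‖x‖²` contributes to the imaginary part of `⟨x, y - z x⟩`; Cauchy–Schwarz does the rest.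
-/
theorem abs_im_mul_norm_le_norm_sub_smul {x y : E} (h : (inner ℂ x y).im = 0) (z : ℂ) :
    |z.im| * ‖x‖ ≤ ‖y - z • x‖ := by
  have h2 : (inner ℂ x (y - z • x)).im = -z.im * ‖x‖ ^ 2 := by
    rw [inner_sub_right, inner_smul_right, inner_self_eq_norm_sq_to_K, Complex.sub_im, h]
    have : ((‖x‖ : ℂ) ^ 2) = ((‖x‖ ^ 2 : ℝ) : ℂ) := by push_cast; rfl
    simp only [Complex.coe_algebraMap]
    rw [this, Complex.mul_im, Complex.ofReal_re, Complex.ofReal_im]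
    ring
  have h3 : |z.im| * ‖x‖ ^ 2 ≤ ‖x‖ * ‖y - z • x‖ := by
    calc |z.im| * ‖x‖ ^ 2 = |(inner ℂ x (y - z • x)).im| := by
          rw [h2, abs_mul, abs_neg, abs_of_nonneg (sq_nonneg ‖x‖)]
      _ ≤ ‖inner ℂ x (y - z • x)‖ := Complex.abs_im_le_norm _
      _ ≤ _ := norm_inner_le_norm _ _
  rcases (norm_nonneg x).eq_or_lt with h0 | h0
  · rw [← h0, mul_zero]; exact norm_nonneg _
  · refine le_of_mul_le_mul_left ?_ h0
    linarith [h3]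

theorem im_inner_eq_zero_of_symm {x y : E} (h : inner ℂ y x = inner ℂ x y) :
    (inner ℂ x y).im = 0 := by
  have h' := inner_conj_symm (𝕜 := ℂ) y x
  rw [h] at h'
  exact Complex.conj_eq_iff_im.1 h'

/-- A formally self-adjoint operator is bounded below away from the real axis. -/
theorem abs_im_mul_norm_le {T : E →ₗ.[ℂ] E} (hT : T.IsFormalAdjoint T) (z : ℂ) (x : T.domain) :
    |z.im| * ‖(x : E)‖ ≤ ‖T x - z • (x : E)‖ :=
  abs_im_mul_norm_le_norm_sub_smul (im_inner_eq_zero_of_symm (hT x x)) z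

theorem IsResolventAt.unique {T : E →ₗ.[ℂ] E} {z : ℂ} {R R' : E →L[ℂ] E}
    (h : IsResolventAt T z R) (h' : IsResolventAt T z R') : R = R' := by
  ext x
  obtain ⟨hx, e⟩ := h.1 x
  have e' := h'.2 ⟨R x, hx⟩
  rw [e] at e'
  exact e'.symm

/-- A bounded operator commuting with one resolvent of `T` commutes with every resolvent. -/
theorem IsResolventAt.commute {T : E →ₗ.[ℂ] E} {z w : ℂ} {R Q B : E →L[ℂ] E}
    (hR : IsResolventAt T z R) (hQ : IsResolventAt T w Q) (hB : Commute B R) : Commute B Q := by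
  have hc : ∀ x, B (R x) = R (B x) := fun x => DFunLike.congr_fun hB.eq x
  -- `B` preserves the domain of `T` and commutes with `T` there: writing `x = R y` gives `B x = R
  -- (B y)`. This no longer mentions `z`, so it can be used at `w`.
  have key : ∀ x : T.domain, ∃ h : B x ∈ T.domain, T ⟨B x, h⟩ = B (T x) := by
    intro x
    have e1 := hR.2 x
    set y := T x - z • (x : E) with hy
    obtain ⟨h2, e2⟩ := hR.1 (B y)
    have e3 : R (B y) = B x := by rw [← hc, e1]
    refine ⟨e3 ▸ h2, ?_⟩
    have e4 : (⟨R (B y), h2⟩ : T.domain) = ⟨B x, e3 ▸ h2⟩ := Subtype.ext e3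
    have e5 : B y = B (T x) - z • B x := by rw [hy, map_sub, map_smul]
    have e6 : z • R (B y) = z • B x := by rw [e3]
    rw [← e4, ← sub_left_inj (a := z • R (B y)), e2, e6, e5]
  refine ContinuousLinearMap.ext fun x => ?_
  change B (Q x) = Q (B x)
  obtain ⟨h1, e1⟩ := hQ.1 x
  obtain ⟨h2, e2⟩ := key ⟨Q x, h1⟩
  have e3 := hQ.2 ⟨B (Q x), h2⟩
  have e4 : T ⟨B (Q x), h2⟩ - w • B (Q x) = B x := by
    conv_rhs => rw [← e1]
    rw [map_sub, map_smul]
    exact congrArg (· - w • B (Q x)) e2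
  rw [← e4]
  exact e3.symm

/-- One commuting pair of resolvents suffices: `IsResolventAt.commute` moves first one spectral
parameter, then the other. -/
theorem stronglyCommute_of_commute {S T : E →ₗ.[ℂ] E} {z w : ℂ} {R Q : E →L[ℂ] E}
    (hR : IsResolventAt S z R) (hQ : IsResolventAt T w Q) (h : Commute R Q) :
    StronglyCommute S T := fun _ _ _ _ hR' hQ' =>
  (hR.commute hR' (hQ.commute hQ' h).symm).symm

variable [CompleteSpace E]

/-- `T - z` is viewed as a bounded map `F` on the graph of `T`, which is complete because `T` is
closed. `F` is bounded below in the graph norm, so its range is closed; being dense, it is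
everything. -/
theorem exists_isResolventAt_of_dense {T : E →ₗ.[ℂ] E} (hT : T.IsFormalAdjoint T)
    (hcl : T.IsClosed) {z : ℂ} (hz : z.im ≠ 0)
    (hd : DenseRange fun x : T.domain => T x - z • (x : E)) :
    ∃ R : E →L[ℂ] E, IsResolventAt T z R := by
  have hz' : 0 < |z.im| := abs_pos.2 hz
  let F : T.graph →L[ℂ] E :=
    (ContinuousLinearMap.snd ℂ E E - z • ContinuousLinearMap.fst ℂ E E) ∘L T.graph.subtypeL
  have hF : ∀ p : T.graph, F p = p.1.2 - z • p.1.1 := fun p => rfl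
  have hmem : ∀ p : T.graph, ∃ h : p.1.1 ∈ T.domain, T ⟨p.1.1, h⟩ = p.1.2 := by
    intro p
    obtain ⟨y, h1, h2⟩ := (LinearPMap.mem_graph_iff T).1 p.2
    exact ⟨h1 ▸ y.2, by rw [← h2]; congr 1; exact Subtype.ext h1.symm⟩
  have hb : ∀ p : T.graph, |z.im| * ‖p.1.1‖ ≤ ‖F p‖ := by
    intro p
    obtain ⟨h, e⟩ := hmem p
    have := abs_im_mul_norm_le hT z ⟨p.1.1, h⟩
    rwa [e] at this
  have hc : ∀ p : T.graph, ‖p‖ ≤ (1 + (1 + ‖z‖) / |z.im|) * ‖F p‖ := by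
    intro p
    have h1 : ‖p.1.1‖ ≤ ‖F p‖ / |z.im| := by
      rw [le_div_iff₀ hz', mul_comm]; exact hb p
    have h2 : ‖p.1.2‖ ≤ ‖F p‖ + ‖z‖ * ‖p.1.1‖ := by
      have : p.1.2 = F p + z • p.1.1 := by rw [hF]; abel
      rw [this, ← norm_smul]; exact norm_add_le _ _
    have h3 : ‖z‖ * ‖p.1.1‖ ≤ ‖z‖ * (‖F p‖ / |z.im|) :=
      mul_le_mul_of_nonneg_left h1 (norm_nonneg _)
    have e : (1 + (1 + ‖z‖) / |z.im|) * ‖F p‖ =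
        ‖F p‖ + ‖F p‖ / |z.im| + ‖z‖ * (‖F p‖ / |z.im|) := by ring
    have h4 : 0 ≤ ‖F p‖ / |z.im| := by positivity
    have h5 : 0 ≤ ‖z‖ * (‖F p‖ / |z.im|) := by positivity
    rw [e]
    refine max_le ?_ ?_
    · change ‖p.1.1‖ ≤ _
      linarith [norm_nonneg (F p)]
    · change ‖p.1.2‖ ≤ _
      linarith
  have : CompleteSpace T.graph := hcl.completeSpace_coe
  have hanti : AntilipschitzWith (Real.toNNReal (1 + (1 + ‖z‖) / |z.im|)) F := by
    refine AddMonoidHomClass.antilipschitz_of_bound F fun p => ?_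
    rw [Real.coe_toNNReal _ (by positivity)]
    exact hc p
  have hrange : Set.range F = Set.univ := by
    have h1 : IsClosed (Set.range F) := hanti.isClosed_range F.uniformContinuous
    have h2 : Dense (Set.range F) := by
      refine hd.mono ?_
      rintro _ ⟨x, rfl⟩
      exact ⟨⟨(x, T x), T.mem_graph x⟩, rfl⟩
    rw [← h1.closure_eq, h2.closure_eq]
  let e : T.graph ≃ₗ[ℂ] E := LinearEquiv.ofBijective F.toLinearMap
    ⟨hanti.injective, Set.range_eq_univ.1 hrange⟩
  have he : ∀ p, e p = F p := fun p => rfl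
  let R : E →L[ℂ] E := LinearMap.mkContinuous
    (LinearMap.fst ℂ E E ∘ₗ T.graph.subtype ∘ₗ e.symm.toLinearMap) (1 / |z.im|) (by
      intro x
      change ‖(e.symm x).1.1‖ ≤ _
      have := hb (e.symm x)
      rw [← he, e.apply_symm_apply] at this
      rw [one_div, inv_mul_eq_div, le_div_iff₀ hz', mul_comm]
      exact this)
  have hR : ∀ x, R x = (e.symm x).1.1 := fun x => rfl
  refine ⟨R, fun x => ?_, fun x => ?_⟩
  · obtain ⟨h, e1⟩ := hmem (e.symm x)
    refine ⟨h, ?_⟩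
    have e2 : (⟨R x, h⟩ : T.domain) = ⟨(e.symm x).1.1, h⟩ := rfl
    rw [e2, e1, hR, ← hF, ← he, e.apply_symm_apply]
  · have : T x - z • (x : E) = e ⟨(x, T x), T.mem_graph x⟩ := rfl
    rw [hR, this, e.symm_apply_apply]

theorem isFormalAdjoint_of_isSelfAdjoint {T : E →ₗ.[ℂ] E} (hT : IsSelfAdjoint T) :
    T.IsFormalAdjoint T := by
  have h := LinearPMap.adjoint_isFormalAdjoint (T := T) hT.dense_domain
  rwa [LinearPMap.isSelfAdjoint_def.1 hT] at h

/-- A vector orthogonal to the range of `T - z` is an eigenvector of the adjoint, hence of `T`, with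
eigenvalue the conjugate of `z`. The lower bound forces it to vanish. -/
theorem exists_isResolventAt_of_isSelfAdjoint {T : E →ₗ.[ℂ] E} (hT : IsSelfAdjoint T) {z : ℂ}
    (hz : z.im ≠ 0) : ∃ R : E →L[ℂ] E, IsResolventAt T z R := by
  have hsym := isFormalAdjoint_of_isSelfAdjoint hT
  refine exists_isResolventAt_of_dense hsym hT.isClosed hz ?_
  let W : Submodule ℂ E := LinearMap.range (T.toFun - z • T.domain.subtype)
  have hW : Set.range (fun x : T.domain => T x - z • (x : E)) = (W : Set E) := rfl
  rw [DenseRange, hW, ← Submodule.dense_iff_topologicalClosure_eq_top.symm,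
    Submodule.topologicalClosure_eq_top_iff, Submodule.eq_bot_iff]
  intro y hy
  have h1 : ∀ x : T.domain, inner ℂ ((starRingEnd ℂ z) • y) (x : E) = inner ℂ y (T x) := by
    intro x
    have := (Submodule.mem_orthogonal' W y).1 hy (T x - z • (x : E)) ⟨x, rfl⟩
    rw [inner_sub_right, inner_smul_right, sub_eq_zero] at this
    rw [inner_smul_left, this, RingHomCompTriple.comp_apply, RingHom.id_apply]
  have h2 : y ∈ T.adjoint.domain := LinearPMap.mem_adjoint_domain_of_exists y ⟨_, h1⟩
  have h3 : T.adjoint ⟨y, h2⟩ = (starRingEnd ℂ z) • y :=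
    LinearPMap.adjoint_apply_eq hT.dense_domain _ h1
  have h4 : ∀ S : E →ₗ.[ℂ] E, S = T → ∀ h : y ∈ S.domain, S ⟨y, h⟩ = (starRingEnd ℂ z) • y →
      y = 0 := by
    rintro S rfl h e
    have := abs_im_mul_norm_le hsym (starRingEnd ℂ z) ⟨y, h⟩
    rw [e, sub_self, norm_zero, Complex.conj_im, abs_neg] at this
    have h0 : 0 < |z.im| := abs_pos.2 hz
    exact norm_le_zero_iff.1 (nonpos_of_mul_nonpos_right this h0)
  exact h4 _ (LinearPMap.isSelfAdjoint_def.1 hT) h2 h3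

/-- The basic criterion for essential self-adjointness. -/
theorem isEssentiallySelfAdjoint_of_dense {T : E →ₗ.[ℂ] E} (hdom : Dense (T.domain : Set E))
    (hT : T.IsFormalAdjoint T)
    (h1 : DenseRange fun x : T.domain => T x - Complex.I • (x : E))
    (h2 : DenseRange fun x : T.domain => T x - (-Complex.I) • (x : E)) :
    IsEssentiallySelfAdjoint T := by
  have hclosable : T.IsClosable :=
    (LinearPMap.adjoint_isClosed hdom).isClosable.leIsClosable (hT.le_adjoint hdom)
  set A := T.closure with hA
  have hle : T ≤ A := T.le_closure
  have hAdom : Dense (A.domain : Set E) := hdom.mono hle.1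
  have hAcl : A.IsClosed := hclosable.closure_isClosed
  have hgraph : (A.graph : Set (E × E)) = closure (T.graph : Set (E × E)) := by
    rw [hA, ← hclosable.graph_closure_eq_closure_graph, Submodule.topologicalClosure_coe]
  -- Symmetry is a closed condition on pairs of graph points, so it passes to the closure in one
  -- variable at a time.
  have hsymg : ∀ p ∈ (A.graph : Set (E × E)), ∀ q ∈ (A.graph : Set (E × E)),
      inner ℂ p.2 q.1 = inner ℂ p.1 q.2 := by
    have s0 : ∀ p ∈ (T.graph : Set (E × E)), ∀ q ∈ (T.graph : Set (E × E)),
        inner ℂ p.2 q.1 = inner ℂ p.1 q.2 := by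
      intro p hp q hq
      obtain ⟨x, hx1, hx2⟩ := (LinearPMap.mem_graph_iff T).1 hp
      obtain ⟨y, hy1, hy2⟩ := (LinearPMap.mem_graph_iff T).1 hq
      rw [← hx1, ← hx2, ← hy1, ← hy2]
      exact hT x y
    have s1 : ∀ p ∈ (T.graph : Set (E × E)), ∀ q ∈ closure (T.graph : Set (E × E)),
        inner ℂ p.2 q.1 = inner ℂ p.1 q.2 := by
      intro p hp
      refine closure_minimal (s0 p hp) (t := {q : E × E | inner ℂ p.2 q.1 = inner ℂ p.1 q.2}) ?_
      exact isClosed_eq (by fun_prop) (by fun_prop)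
    rw [hgraph]
    intro p hp q hq
    refine closure_minimal (fun p hp => s1 p hp q hq)
      (t := {p : E × E | inner ℂ p.2 q.1 = inner ℂ p.1 q.2}) ?_ hp
    exact isClosed_eq (by fun_prop) (by fun_prop)
  have hAsym : A.IsFormalAdjoint A := fun x y =>
    hsymg _ (A.mem_graph x) _ (A.mem_graph y)
  have hres : ∀ z : ℂ, DenseRange (fun x : T.domain => T x - z • (x : E)) →
      DenseRange fun x : A.domain => A x - z • (x : E) := by
    intro z hz
    refine hz.mono ?_
    rintro _ ⟨x, rfl⟩
    exact ⟨⟨x, hle.1 x.2⟩, congrArg (· - z • (x : E)) (hle.2 (x := x) (y := ⟨x, hle.1 x.2⟩) rfl).symm⟩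
  obtain ⟨R, hR⟩ := exists_isResolventAt_of_dense hAsym hAcl (z := Complex.I) (by simp) (hres _ h1)
  obtain ⟨Q, hQ⟩ := exists_isResolventAt_of_dense hAsym hAcl (z := -Complex.I) (by simp)
    (hres _ h2)
  refine ⟨hdom, hclosable, ?_⟩
  rw [LinearPMap.isSelfAdjoint_def]
  have hle' := hAsym.le_adjoint hAdom
  refine le_antisymm ?_ hle'
  have key : ∀ y : A.adjoint.domain, (y : E) ∈ A.domain := by
    intro y
    obtain ⟨x, hx, ex⟩ : ∃ (x : E) (hx : x ∈ A.domain),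
        A ⟨x, hx⟩ - Complex.I • x = A.adjoint y - Complex.I • (y : E) :=
      ⟨_, hR.1 (A.adjoint y - Complex.I • (y : E))⟩
    -- By the choice of `x`, `A* y - A x = i (y - x)`. This makes `y - x` orthogonal to the range of
    -- `A + i`, which is the whole space since `Q` exists; so `y = x` lies in the domain.
    have h0 : ∀ v : E, inner ℂ ((y : E) - x) v = 0 := by
      intro v
      obtain ⟨hu, eu⟩ := hQ.1 v
      have a1 := LinearPMap.adjoint_isFormalAdjoint hAdom y ⟨Q v, hu⟩
      have a2 := hAsym ⟨x, hx⟩ ⟨Q v, hu⟩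
      have a3 : A.adjoint y - A ⟨x, hx⟩ = Complex.I • ((y : E) - x) := by
        rw [smul_sub, sub_eq_sub_iff_sub_eq_sub, ← ex]
      have a4 : inner ℂ ((y : E) - x) (A ⟨Q v, hu⟩) =
          inner ℂ (Complex.I • ((y : E) - x)) (Q v) := by
        rw [← a3, inner_sub_left, inner_sub_left, a1, a2]
      rw [← eu, inner_sub_right, a4, inner_smul_left, inner_smul_right, Complex.conj_I, sub_self]
    have h1 : (y : E) - x = 0 := by
      have := h0 ((y : E) - x)
      rwa [inner_self_eq_zero] at this
    rw [sub_eq_zero.1 h1]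
    exact hx
  refine LinearPMap.le_of_eqLocus_ge fun y hy => ?_
  exact ⟨hy, key ⟨y, hy⟩, (hle'.2 (x := ⟨y, key ⟨y, hy⟩⟩) (y := ⟨y, hy⟩) rfl).symm⟩

/-- An operator with self-adjoint closure and approximate eigenvectors at every non-zero real
number has spectrum `ℝ`. -/
theorem spectrumOf_closure_eq_range {T : E →ₗ.[ℂ] E} (hT : IsEssentiallySelfAdjoint T)
    (h : ∀ l : ℝ, l ≠ 0 → ∀ δ : ℝ, 0 < δ →
      ∃ x : T.domain, ‖T x - (l : ℂ) • (x : E)‖ < δ * ‖(x : E)‖) :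
    spectrumOf T.closure = Set.range ((↑) : ℝ → ℂ) := by
  have h' : ∀ l δ : ℝ, 0 < δ →
      ∃ x : T.domain, ‖T x - (l : ℂ) • (x : E)‖ < δ * ‖(x : E)‖ := by
    intro l δ hδ
    by_cases hl : l = 0
    -- The value `0` is approached by the admissible value `δ / 2`; the other half of `δ` pays for
    -- the shift.
    · obtain ⟨x, hx⟩ := h (δ / 2) (by positivity) (δ / 2) (by positivity)
      refine ⟨x, ?_⟩
      have e : T x - (l : ℂ) • (x : E) =
          (T x - ((δ / 2 : ℝ) : ℂ) • (x : E)) + ((δ / 2 : ℝ) : ℂ) • (x : E) := by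
        rw [hl]; simp
      rw [e]
      refine (norm_add_le _ _).trans_lt ?_
      rw [norm_smul, Complex.norm_real, Real.norm_of_nonneg (by positivity)]
      linarith
    · exact h l hl δ hδ
  ext z
  constructor
  · intro hz
    by_contra hr
    refine hz (exists_isResolventAt_of_isSelfAdjoint hT.2.2 fun h0 => hr ⟨z.re, ?_⟩)
    exact Complex.ext rfl h0.symm
  · rintro ⟨l, rfl⟩ ⟨R, hR⟩
    -- With this tolerance `‖R‖ ‖(T - l) x‖ < ‖x‖`, against `x = R ((T - l) x)`.
    obtain ⟨x, hx⟩ := h' l (1 / (‖R‖ + 1)) (by positivity)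
    have hle : T ≤ T.closure := T.le_closure
    have e1 := hR.2 ⟨x, hle.1 x.2⟩
    rw [← hle.2 (x := x) (y := ⟨x, hle.1 x.2⟩) rfl] at e1
    have e2 := R.le_opNorm (T x - (l : ℂ) • (x : E))
    simp only at e1
    rw [e1] at e2
    have h3 : ‖T x - (l : ℂ) • (x : E)‖ * (‖R‖ + 1) < ‖(x : E)‖ := by
      rw [one_div, inv_mul_eq_div, lt_div_iff₀ (by positivity)] at hx
      exact hx
    nlinarith [norm_nonneg (T x - (l : ℂ) • (x : E))]

/-- On `x = (T - i)(S - i) y = (S - i)(T - i) y` both products of the resolvents at `i` return `y`.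
Continuity extends the equality from `X` to the whole space. -/
theorem stronglyCommute_closure {S T : E →ₗ.[ℂ] E} (hS : IsEssentiallySelfAdjoint S)
    (hT : IsEssentiallySelfAdjoint T)
    {X : Set E} (hX : Dense X)
    (h : ∀ x ∈ X, ∃ (y : E) (h1 : y ∈ S.domain) (h2 : y ∈ T.domain)
      (h3 : S ⟨y, h1⟩ - Complex.I • y ∈ T.domain) (h4 : T ⟨y, h2⟩ - Complex.I • y ∈ S.domain),
      T ⟨_, h3⟩ - Complex.I • (S ⟨y, h1⟩ - Complex.I • y) = x ∧
      S ⟨_, h4⟩ - Complex.I • (T ⟨y, h2⟩ - Complex.I • y) = x) :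
    StronglyCommute S.closure T.closure := by
  obtain ⟨R, hR⟩ := exists_isResolventAt_of_isSelfAdjoint hS.2.2 (z := Complex.I) (by simp)
  obtain ⟨Q, hQ⟩ := exists_isResolventAt_of_isSelfAdjoint hT.2.2 (z := Complex.I) (by simp)
  have hR' : ∀ x : S.domain, R (S x - Complex.I • (x : E)) = x := by
    intro x
    have hle : S ≤ S.closure := S.le_closure
    rw [hle.2 (x := x) (y := ⟨x, hle.1 x.2⟩) rfl]
    exact hR.2 ⟨x, hle.1 x.2⟩
  have hQ' : ∀ x : T.domain, Q (T x - Complex.I • (x : E)) = x := by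
    intro x
    have hle : T ≤ T.closure := T.le_closure
    rw [hle.2 (x := x) (y := ⟨x, hle.1 x.2⟩) rfl]
    exact hQ.2 ⟨x, hle.1 x.2⟩
  refine stronglyCommute_of_commute hR hQ ?_
  refine ContinuousLinearMap.ext fun x => ?_
  refine congrFun (hX.induction (P := fun x => R (Q x) = Q (R x)) ?_
    (isClosed_eq (by fun_prop) (by fun_prop))  |> funext) x
  intro x hx
  obtain ⟨y, h1, h2, h3, h4, e1, e2⟩ := h x hx
  have a1 := hQ' ⟨_, h3⟩
  have a2 := hR' ⟨_, h1⟩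
  have b1 := hR' ⟨_, h4⟩
  have b2 := hQ' ⟨_, h2⟩
  rw [e1] at a1
  rw [e2] at b1
  rw [a1, b1, a2, b2]

end Operators

end PhotonHamiltonian

/-! ### Operators induced on a space of test fields, and commuting pairs. -/

namespace PhotonHamiltonian

theorem inner_eq_zero_of_mem_completion {D : Submodule ℂ TestFields} {ξ η : L2Fields}
    (h : ∀ φ ∈ D, inner ℂ (toL2 φ) ξ = 0) (hη : η ∈ completion D) : inner ℂ η ξ = 0 := by
  refine closure_minimal (t := {η : L2Fields | inner ℂ η ξ = 0}) ?_
    (isClosed_eq (by fun_prop) (by fun_prop)) hη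
  rintro _ ⟨φ, hφ, rfl⟩
  exact h φ hφ

theorem dense_range_toCompletion (D : Submodule ℂ TestFields) :
    Dense (LinearMap.range (toCompletion D) : Set (completion D)) := by
  rw [Submodule.dense_iff_topologicalClosure_eq_top, Submodule.topologicalClosure_eq_top_iff,
    Submodule.eq_bot_iff]
  intro η hη
  have h1 : inner ℂ (η : L2Fields) (η : L2Fields) = 0 :=
    inner_eq_zero_of_mem_completion (fun φ hφ =>
      (Submodule.mem_orthogonal _ η).1 hη (toCompletion D ⟨φ, hφ⟩) ⟨_, rfl⟩) η.2
  exact Subtype.ext (inner_self_eq_zero.1 h1)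

/-- The orthogonal projection sees only inner products with `D`. This is what allows `H` to be
replaced by a compression that preserves `D`. -/
theorem inducedOperator_congr {D : Submodule ℂ TestFields} {H S : TestFields →ₗ[ℂ] TestFields}
    (h : ∀ φ ∈ D, ∀ ψ ∈ D, inner ℂ (toL2 φ) (toL2 (H ψ)) = inner ℂ (toL2 φ) (toL2 (S ψ))) :
    inducedOperator D H = inducedOperator D S := by
  refine LinearPMap.ext rfl fun x hf hg => ?_
  obtain ⟨ψ, hψ⟩ := (LinearEquiv.ofInjective (toCompletion D) (toCompletion_injective D)).surjective
    ⟨x, hf⟩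
  change (completion D).orthogonalProjectionOnto (toL2 (H (D.subtype
    ((LinearEquiv.ofInjective (toCompletion D) (toCompletion_injective D)).symm ⟨x, hf⟩)))) =
    (completion D).orthogonalProjectionOnto (toL2 (S (D.subtype
    ((LinearEquiv.ofInjective (toCompletion D) (toCompletion_injective D)).symm ⟨x, hf⟩))))
  rw [← hψ, LinearEquiv.symm_apply_apply, ← sub_eq_zero, ← map_sub,
    Submodule.orthogonalProjectionOnto_eq_zero_iff, Submodule.mem_orthogonal]
  intro u hu
  refine inner_eq_zero_of_mem_completion (fun φ hφ => ?_) hu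
  rw [inner_sub_right, sub_eq_zero]
  exact h φ hφ _ ψ.2

/-- `S - z`. -/
noncomputable def shift (S : TestFields →ₗ[ℂ] TestFields) (z : ℂ) : TestFields →ₗ[ℂ] TestFields :=
  S - z • (LinearMap.id : TestFields →ₗ[ℂ] TestFields)

theorem shift_apply (S : TestFields →ₗ[ℂ] TestFields) (z : ℂ) (φ : TestFields) :
    shift S z φ = S φ - z • φ := rfl

/-- Two symmetric operators which map a space `D` of test fields into itself, commute on it, and
whose shifted product has dense range. -/
structure IsCommutingPair (D : Submodule ℂ TestFields) (S P : TestFields →ₗ[ℂ] TestFields) :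
    Prop where
  mapsTo_left : ∀ φ ∈ D, S φ ∈ D
  mapsTo_right : ∀ φ ∈ D, P φ ∈ D
  symm_left : ∀ φ ∈ D, ∀ ψ ∈ D, inner ℂ (toL2 (S φ)) (toL2 ψ) = inner ℂ (toL2 φ) (toL2 (S ψ))
  symm_right : ∀ φ ∈ D, ∀ ψ ∈ D, inner ℂ (toL2 (P φ)) (toL2 ψ) = inner ℂ (toL2 φ) (toL2 (P ψ))
  comm : ∀ φ ∈ D, S (P φ) = P (S φ)
  dense : ∀ z w : ℂ, z.im ≠ 0 → w.im ≠ 0 → ∀ η ∈ completion D,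
    (∀ φ ∈ D, inner ℂ (toL2 (shift S z (shift P w φ))) η = 0) → η = 0

theorem isFormalAdjoint_inducedOperator {D : Submodule ℂ TestFields}
    {S : TestFields →ₗ[ℂ] TestFields} (hS : ∀ φ ∈ D, S φ ∈ D)
    (h : ∀ φ ∈ D, ∀ ψ ∈ D, inner ℂ (toL2 (S φ)) (toL2 ψ) = inner ℂ (toL2 φ) (toL2 (S ψ))) :
    (inducedOperator D S).IsFormalAdjoint (inducedOperator D S) := by
  rintro ⟨_, φ, rfl⟩ ⟨_, ψ, rfl⟩
  rw [inducedOperator_apply D S φ (hS _ φ.2), inducedOperator_apply D S ψ (hS _ ψ.2)]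
  exact h _ φ.2 _ ψ.2

namespace IsCommutingPair

variable {D : Submodule ℂ TestFields} {S P : TestFields →ₗ[ℂ] TestFields}

theorem symm (h : IsCommutingPair D S P) : IsCommutingPair D P S where
  mapsTo_left := h.mapsTo_right
  mapsTo_right := h.mapsTo_left
  symm_left := h.symm_right
  symm_right := h.symm_left
  comm φ hφ := (h.comm φ hφ).symm
  dense z w hz hw η hη hh := by
    refine h.dense w z hw hz η hη fun φ hφ => ?_
    rw [← hh φ hφ]
    congr 2
    have := h.comm φ hφ
    simp only [shift_apply, map_sub, map_smul,
      this, smul_sub, smul_comm z w]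
    abel

theorem sub_smul_mem (h : IsCommutingPair D S P) (z : ℂ) {φ : TestFields} (hφ : φ ∈ D) :
    shift S z φ ∈ D :=
  D.sub_mem (h.mapsTo_left φ hφ) (D.smul_mem z hφ)

/-- The vectors `(S - z) (P - w) φ`. -/
def shiftedRange (h : IsCommutingPair D S P) (z w : ℂ) : Set (completion D) :=
  Set.range fun φ : D => toCompletion D
    ⟨shift S z (shift P w φ.1),
      h.sub_smul_mem z (h.symm.sub_smul_mem w φ.2)⟩

theorem dense_shiftedRange (h : IsCommutingPair D S P) {z w : ℂ} (hz : z.im ≠ 0)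
    (hw : w.im ≠ 0) : Dense (h.shiftedRange z w) := by
  let F : D →ₗ[ℂ] completion D := toCompletion D ∘ₗ
    (shift S z ∘ₗ shift P w).restrict (p := D) (q := D)
      fun φ hφ => h.sub_smul_mem z (h.symm.sub_smul_mem w hφ)
  have hF : h.shiftedRange z w = (LinearMap.range F : Set (completion D)) := rfl
  rw [hF, Submodule.dense_iff_topologicalClosure_eq_top, Submodule.topologicalClosure_eq_top_iff,
    Submodule.eq_bot_iff]
  intro η hη
  refine Subtype.ext (h.dense z w hz hw η η.2 fun φ hφ => ?_)
  exact (Submodule.mem_orthogonal _ η).1 hη (F ⟨φ, hφ⟩) ⟨_, rfl⟩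

theorem inducedOperator_sub (h : IsCommutingPair D S P) (z : ℂ) (φ : D) :
    inducedOperator D S ⟨toCompletion D φ, LinearMap.mem_range_self _ φ⟩ -
      z • toCompletion D φ =
      toCompletion D ⟨shift S z φ.1, h.sub_smul_mem z φ.2⟩ := by
  rw [inducedOperator_apply D S φ (h.mapsTo_left _ φ.2), ← map_smul, ← map_sub]
  rfl

/-- The range of `S - z` contains every `(S - z)(P - w)φ`, so it is dense; the choice `w = i` is
arbitrary. -/
theorem isEssentiallySelfAdjoint (h : IsCommutingPair D S P) :
    IsEssentiallySelfAdjoint (inducedOperator D S) := by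
  have hd : ∀ z : ℂ, z.im ≠ 0 → DenseRange fun x : (inducedOperator D S).domain =>
      inducedOperator D S x - z • (x : completion D) := by
    intro z hz
    refine (h.dense_shiftedRange hz (w := Complex.I) (by simp)).mono ?_
    rintro _ ⟨φ, rfl⟩
    exact ⟨⟨toCompletion D ⟨_, h.symm.sub_smul_mem Complex.I φ.2⟩, LinearMap.mem_range_self _ _⟩,
      h.inducedOperator_sub z ⟨_, h.symm.sub_smul_mem Complex.I φ.2⟩⟩
  exact isEssentiallySelfAdjoint_of_dense (dense_range_toCompletion D)
    (isFormalAdjoint_inducedOperator h.mapsTo_left h.symm_left) (hd _ (by simp)) (hd _ (by simp))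

theorem stronglyCommute (h : IsCommutingPair D S P) :
    StronglyCommute (inducedOperator D S).closure (inducedOperator D P).closure := by
  refine stronglyCommute_closure h.isEssentiallySelfAdjoint h.symm.isEssentiallySelfAdjoint
    (h.dense_shiftedRange (z := Complex.I) (w := Complex.I) (by simp) (by simp)) ?_
  rintro _ ⟨φ, rfl⟩
  have e1 := h.inducedOperator_sub Complex.I φ
  have e2 := h.symm.inducedOperator_sub Complex.I φ
  have f1 := h.symm.inducedOperator_sub Complex.I ⟨_, h.sub_smul_mem Complex.I φ.2⟩
  have f2 := h.inducedOperator_sub Complex.I ⟨_, h.symm.sub_smul_mem Complex.I φ.2⟩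
  refine ⟨toCompletion D φ, LinearMap.mem_range_self _ φ, LinearMap.mem_range_self _ φ, ?_, ?_,
    ?_, ?_⟩
  · rw [e1]; exact LinearMap.mem_range_self _ _
  · rw [e2]; exact LinearMap.mem_range_self _ _
  · simp only [e1]
    refine f1.trans (congrArg _ (Subtype.ext ?_))
    have := h.comm φ.1 φ.2
    simp only [shift_apply, map_sub, map_smul,
      this, smul_sub]
    abel
  · simp only [e2]
    exact f2

/-- Transfer of the conclusions to an operator with the same matrix elements as `S`. -/
theorem stronglyCommute_of_inner_eq (h : IsCommutingPair D S P) {H : TestFields →ₗ[ℂ] TestFields}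
    (hH : ∀ φ ∈ D, ∀ ψ ∈ D, inner ℂ (toL2 φ) (toL2 (H ψ)) = inner ℂ (toL2 φ) (toL2 (S ψ))) :
    StronglyCommute (inducedOperator D H).closure (inducedOperator D P).closure := by
  rw [inducedOperator_congr hH]
  exact h.stronglyCommute

theorem spectrum_of_inner_eq (h : IsCommutingPair D S P) {H : TestFields →ₗ[ℂ] TestFields}
    (hH : ∀ φ ∈ D, ∀ ψ ∈ D, inner ℂ (toL2 φ) (toL2 (H ψ)) = inner ℂ (toL2 φ) (toL2 (S ψ)))
    (hspec : ∀ l : ℝ, l ≠ 0 → ∀ δ : ℝ, 0 < δ →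
      ∃ φ ∈ D, ‖toL2 (S φ - (l : ℂ) • φ)‖ < δ * ‖toL2 φ‖) :
    IsEssentiallySelfAdjoint (inducedOperator D H) ∧
      spectrumOf (inducedOperator D H).closure = Set.range ((↑) : ℝ → ℂ) := by
  rw [inducedOperator_congr hH]
  refine ⟨h.isEssentiallySelfAdjoint, spectrumOf_closure_eq_range h.isEssentiallySelfAdjoint ?_⟩
  intro l hl δ hδ
  obtain ⟨φ, hφ, hlt⟩ := hspec l hl δ hδ
  refine ⟨⟨toCompletion D ⟨φ, hφ⟩, LinearMap.mem_range_self _ _⟩, ?_⟩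
  rw [h.inducedOperator_sub l ⟨φ, hφ⟩]
  exact hlt

end IsCommutingPair

end PhotonHamiltonian

namespace PhotonHamiltonian

open scoped FourierTransform SchwartzMap LineDeriv

/-! ### Fourier transforms of test fields -/

/-- Pointwise application of a linear map of the fibre to test fields. -/
noncomputable def mapT (l : BiSpinor →L[ℂ] BiSpinor) : TestFields →ₗ[ℂ] TestFields where
  toFun φ := ⟨fun x => l (φ.1 x), (l.restrictScalars ℝ).contDiff.comp φ.2.1,
    φ.2.2.comp_left (g := l) (map_zero _)⟩
  map_add' φ ψ := by ext1; funext x; exact map_add l _ _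
  map_smul' r φ := by ext1; funext x; exact map_smul l _ _

theorem mapT_apply (l : BiSpinor →L[ℂ] BiSpinor) (φ : TestFields) (x : Space) :
    (mapT l φ).1 x = l (φ.1 x) := rfl

/-- Translation of test fields. -/
def translateT (a : Space) (φ : TestFields) : TestFields :=
  ⟨fun x => φ.1 (x + a), φ.2.1.comp (contDiff_id.add contDiff_const),
    φ.2.2.comp_homeomorph (Homeomorph.addRight a)⟩

/-- A test field as a Schwartz function. -/
noncomputable def toSchwartz (φ : TestFields) : 𝓢(Space, BiSpinor) := φ.2.2.toSchwartzMap φ.2.1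

theorem toSchwartz_injective : Function.Injective toSchwartz := fun _ _ h =>
  Subtype.ext (congrArg (fun f : 𝓢(Space, BiSpinor) => (f : Space → BiSpinor)) h)

/-- The Fourier transform of a test field at a point. -/
noncomputable def ft (k : Space) : TestFields →ₗ[ℂ] BiSpinor where
  toFun φ := 𝓕 (toSchwartz φ) k
  map_add' φ ψ := by
    have : toSchwartz (φ + ψ) = toSchwartz φ + toSchwartz ψ := rfl
    rw [this, FourierTransform.fourier_add]; rfl
  map_smul' r φ := by
    have : toSchwartz (r • φ) = r • toSchwartz φ := rfl
    rw [this, FourierTransform.fourier_smul]; rfl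

theorem ft_apply (k : Space) (φ : TestFields) : ft k φ = 𝓕 φ.1 k := rfl

theorem eq_zero_of_ft_eq_zero {φ : TestFields} (h : ∀ k, ft k φ = 0) : φ = 0 := by
  refine toSchwartz_injective ?_
  have h1 : 𝓕 (toSchwartz φ) = 𝓕 (toSchwartz 0) :=
    SchwartzMap.ext fun k => (h k).trans (map_zero (ft k)).symm
  have h2 := congrArg (fun f : 𝓢(Space, BiSpinor) => 𝓕⁻ f) h1
  simpa using h2

theorem integrable_testField (φ : TestFields) : Integrable φ.1 :=
  φ.2.1.continuous.integrable_of_hasCompactSupport φ.2.2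

/-- The factor `2πi` of this convention is the source of the constants `2πħ` and `2πħc` in all later
symbols. -/
theorem ft_partialT (k : Space) (j : Fin 3) (φ : TestFields) :
    ft k (partialT j φ) = (2 * Real.pi * Complex.I * (k j : ℂ)) • ft k φ := by
  have h := SchwartzMap.fourier_lineDerivOp_eq (toSchwartz φ) (EuclideanSpace.single j (1 : ℝ))
  have h1 : toSchwartz (partialT j φ) = ∂_{EuclideanSpace.single j (1 : ℝ)} (toSchwartz φ) := rfl
  have h2 := congrArg (fun f : 𝓢(Space, BiSpinor) => f k) h
  have ht : (fun x : Space => inner ℝ x (EuclideanSpace.single j (1 : ℝ))).HasTemperateGrowth :=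
    ((innerSL ℝ).flip (EuclideanSpace.single j (1 : ℝ) : Space)).hasTemperateGrowth
  change 𝓕 (toSchwartz (partialT j φ)) k = _
  rw [h1]
  refine h2.trans ?_
  simp only [smul_apply]
  rw [SchwartzMap.smulLeftCLM_apply_apply ht]
  have h3 : inner ℝ k (EuclideanSpace.single j (1 : ℝ)) = k j := by
    simp [EuclideanSpace.inner_single_right]
  rw [h3, mul_smul (2 * Real.pi * Complex.I), ← Complex.coe_smul]
  rfl

theorem ft_mapT (k : Space) (l : BiSpinor →L[ℂ] BiSpinor) (φ : TestFields) :
    ft k (mapT l φ) = l (ft k φ) := by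
  rw [ft_apply, ft_apply, Real.fourier_eq, Real.fourier_eq, ← l.integral_comp_comm]
  · refine integral_congr_ae (Filter.Eventually.of_forall fun x => ?_)
    simp only [mapT_apply, Circle.smul_def, map_smul]
  · exact (Real.fourierIntegral_convergent_iff k).2 (integrable_testField φ)

theorem ft_translateT (k a : Space) (φ : TestFields) :
    ft k (translateT a φ) = (Real.fourierChar (inner ℝ a k) : ℂ) • ft k φ := by
  have := congrFun (VectorFourier.fourierIntegral_comp_add_right Real.fourierChar
    (volume : Measure Space) (innerₗ Space) φ.1 a) k
  exact this

theorem toL2_eq_toLp (φ : TestFields) : toL2 φ = (toSchwartz φ).toLp 2 := rfl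

theorem fourier_toL2 (φ : TestFields) : (𝓕 (toL2 φ) : L2Fields) = (𝓕 (toSchwartz φ)).toLp 2 := by
  rw [toL2_eq_toLp, SchwartzMap.toLp_fourier_eq]

theorem inner_toL2_left_eq_integral (φ : TestFields) (η : L2Fields) :
    inner ℂ (toL2 φ) η = ∫ k, inner ℂ (ft k φ) ((𝓕 η : L2Fields) k) := by
  rw [← MeasureTheory.Lp.inner_fourier_eq, L2.inner_def, fourier_toL2]
  refine integral_congr_ae ?_
  filter_upwards [(𝓕 (toSchwartz φ)).coeFn_toLp 2 (volume : Measure Space)] with k hk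
  rw [hk]
  rfl

theorem integrable_inner_ft (φ : TestFields) (η : L2Fields) :
    Integrable fun k => inner ℂ (ft k φ) ((𝓕 η : L2Fields) k) := by
  refine (L2.integrable_inner (𝕜 := ℂ) ((𝓕 (toSchwartz φ)).toLp 2 (volume : Measure Space))
    (𝓕 η : L2Fields)).congr ?_
  filter_upwards [(𝓕 (toSchwartz φ)).coeFn_toLp 2 (volume : Measure Space)] with k hk
  rw [hk]
  rfl

/-- Plancherel: an identity of inner products may be checked pointwise in `k`. The symmetry of all
the multipliers follows from that of their symbols. -/
theorem inner_toL2_congr {φ φ' ψ ψ' : TestFields}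
    (h : ∀ k, inner ℂ (ft k φ) (ft k ψ) = inner ℂ (ft k φ') (ft k ψ')) :
    inner ℂ (toL2 φ) (toL2 ψ) = inner ℂ (toL2 φ') (toL2 ψ') := by
  rw [inner_toL2_left_eq_integral, inner_toL2_left_eq_integral, fourier_toL2, fourier_toL2]
  refine integral_congr_ae ?_
  filter_upwards [(𝓕 (toSchwartz ψ)).coeFn_toLp 2 (volume : Measure Space),
    (𝓕 (toSchwartz ψ')).coeFn_toLp 2 (volume : Measure Space)] with k h1 h2
  rw [h1, h2]
  exact h k

/-- Injectivity of the Fourier transform on `L¹`. -/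
theorem ae_eq_zero_of_fourier_eq_zero {G : Space → ℂ} (hG : Integrable G)
    (h : ∀ a, 𝓕 G a = 0) : ∀ᵐ k, G k = 0 := by
  refine ae_eq_zero_of_integral_contDiff_smul_eq_zero hG.locallyIntegrable fun g hg hc => ?_
  let g' : 𝓢(Space, ℂ) := (hc.comp_left (g := ((↑) : ℝ → ℂ)) rfl).toSchwartzMap
    (Complex.ofRealCLM.contDiff.comp hg)
  -- The multiplication formula, applied to `G` and the inverse transform of the test function,
  -- turns `∫ G g` into an integral against `𝓕 G = 0`.
  have h1 := VectorFourier.integral_fourierIntegral_smul_eq_flip (L := innerₗ Space)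
    (μ := (volume : Measure Space)) (ν := (volume : Measure Space)) (e := Real.fourierChar)
    Real.continuous_fourierChar continuous_inner hG (𝓕⁻ g').integrable
  have h2 : ∫ x, G x • 𝓕 (𝓕⁻ g') x = 0 := by
    have h3 : ∀ ξ, VectorFourier.fourierIntegral Real.fourierChar volume (innerₗ Space) G ξ = 0 :=
      h
    simp only [h3, zero_smul, integral_zero] at h1
    rw [flip_innerₗ] at h1
    exact h1.symm
  rw [← h2, FourierTransform.fourier_fourierInv_eq]
  refine integral_congr_ae (Filter.Eventually.of_forall fun x => ?_)
  change g x • G x = G x • ((g x : ℝ) : ℂ)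
  rw [smul_eq_mul, mul_comm]
  rfl

/-- `L` is the Fourier multiplier with symbol `σ`. -/
def HasSymbol (L : TestFields →ₗ[ℂ] TestFields) (σ : Space → BiSpinor →L[ℂ] BiSpinor) : Prop :=
  ∀ φ k, ft k (L φ) = σ k (ft k φ)

/-- If `η` is orthogonal to the images under a multiplier of all translates of `φ`, then the
Fourier transforms are orthogonal almost everywhere. -/
theorem ae_inner_symbol_eq_zero {L : TestFields →ₗ[ℂ] TestFields}
    {σ : Space → BiSpinor →L[ℂ] BiSpinor} (hL : HasSymbol L σ) (η : L2Fields) (φ : TestFields)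
    (h : ∀ a, inner ℂ (toL2 (L (translateT a φ))) η = 0) :
    ∀ᵐ k, inner ℂ (σ k (ft k φ)) ((𝓕 η : L2Fields) k) = 0 := by
  have h1 : Integrable fun k => inner ℂ (σ k (ft k φ)) ((𝓕 η : L2Fields) k) := by
    simpa only [hL _ _] using integrable_inner_ft (L φ) η
  -- Translating `φ` by `a` multiplies its transform by a character, so the vanishing inner
  -- products, as functions of `a`, are the Fourier transform of this integrable function.
  refine ae_eq_zero_of_fourier_eq_zero h1 fun a => ?_
  rw [Real.fourier_eq, ← h a, inner_toL2_left_eq_integral]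
  refine integral_congr_ae (Filter.Eventually.of_forall fun k => ?_)
  simp only [hL _ _, ft_translateT, map_smul, inner_smul_left]
  rw [Circle.smul_def, smul_eq_mul, real_inner_comm, AddChar.map_neg_eq_inv,
    Circle.coe_inv_eq_conj]

end PhotonHamiltonian

namespace PhotonHamiltonian

/-! ### Algebra of the fibre -/

/-- `σ · k`. -/
def sigmaDot (k : Space) : Matrix (Fin 2) (Fin 2) ℂ :=
  !![(k 2 : ℂ), k 0 - Complex.I * k 1; k 0 + Complex.I * k 1, -(k 2 : ℂ)]

/-- `α · k`, acting on bi-spinors from the left. -/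
noncomputable def diracSymbol (k : Space) : BiSpinor →L[ℂ] BiSpinor :=
  ∑ j, (k j : ℂ) • leftMul (alpha j)

theorem toMat_diracSymbol (k : Space) (A : BiSpinor) :
    toMat (diracSymbol k A) = Matrix.fromBlocks (sigmaDot k) 0 0 (-sigmaDot k) * toMat A := by
  have h : ∑ j, (k j : ℂ) • alpha j = Matrix.fromBlocks (sigmaDot k) 0 0 (-sigmaDot k) := by
    simp only [Fin.sum_univ_three, alpha_eq, Matrix.fromBlocks_smul, Matrix.fromBlocks_add]
    congr 1
    · ext i j
      fin_cases i <;> fin_cases j <;> simp [pauli, sigmaDot] <;> ring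
    · simp
    · simp
    · ext i j
      fin_cases i <;> fin_cases j <;> simp [pauli, sigmaDot] <;> ring
  rw [← h, Finset.sum_mul]
  simp only [diracSymbol, sum_apply, map_sum]
  refine Finset.sum_congr rfl fun j _ => ?_
  rw [smul_apply, map_smul, toMat_leftMul, Matrix.smul_mul]

theorem sigmaDot_conjTranspose (k : Space) : (sigmaDot k).conjTranspose = sigmaDot k := by
  ext i j
  fin_cases i <;> fin_cases j <;> simp [sigmaDot, Matrix.conjTranspose_apply, sub_eq_add_neg]

theorem sigmaDot_mul_self (k : Space) : sigmaDot k * sigmaDot k = ((‖k‖ ^ 2 : ℝ) : ℂ) • 1 := by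
  have hn : ‖k‖ ^ 2 = k 0 ^ 2 + k 1 ^ 2 + k 2 ^ 2 := by
    rw [EuclideanSpace.norm_sq_eq, Fin.sum_univ_three]
    simp [Real.norm_eq_abs, sq_abs]
  rw [hn]
  have hI := Complex.I_sq
  ext i j
  fin_cases i <;> fin_cases j <;> simp [sigmaDot, Matrix.mul_apply, Fin.sum_univ_two] <;>
    first | ring1 | linear_combination (-(k 1 : ℂ) ^ 2) * hI

/-- The Clifford relation: `(σ·k)² = |k|²` in each block, the two signs cancelling. -/
theorem diracSymbol_diracSymbol (k : Space) (A : BiSpinor) :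
    diracSymbol k (diracSymbol k A) = ((‖k‖ ^ 2 : ℝ) : ℂ) • A := by
  refine toMat.injective ?_
  rw [toMat_diracSymbol, toMat_diracSymbol, ← Matrix.mul_assoc, Matrix.fromBlocks_multiply, map_smul]
  simp only [neg_mul_neg, Matrix.mul_zero, Matrix.zero_mul, add_zero, zero_add,
    sigmaDot_mul_self]
  have : Matrix.fromBlocks (((‖k‖ ^ 2 : ℝ) : ℂ) • (1 : Matrix (Fin 2) (Fin 2) ℂ)) 0 0
      (((‖k‖ ^ 2 : ℝ) : ℂ) • 1) = ((‖k‖ ^ 2 : ℝ) : ℂ) • (1 : Mat) := by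
    rw [← Matrix.fromBlocks_one, Matrix.fromBlocks_smul]; simp only [smul_zero]
  rw [this, Matrix.smul_mul, Matrix.one_mul]

theorem inner_def (A B : BiSpinor) :
    inner ℂ A B = ((toMat A).conjTranspose * toMat B).trace := rfl

theorem inner_diracSymbol_left (k : Space) (A B : BiSpinor) :
    inner ℂ (diracSymbol k A) B = inner ℂ A (diracSymbol k B) := by
  rw [inner_def, inner_def, toMat_diracSymbol, toMat_diracSymbol, Matrix.conjTranspose_mul,
    Matrix.fromBlocks_conjTranspose, Matrix.conjTranspose_neg, sigmaDot_conjTranspose,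
    Matrix.conjTranspose_zero, Matrix.mul_assoc]

theorem mem_blockDiag {A : BiSpinor} :
    A ∈ BlockDiag ↔ ∃ X Y : Matrix (Fin 2) (Fin 2) ℂ, toMat A = Matrix.fromBlocks X 0 0 Y := by
  constructor
  · intro h
    refine ⟨(toMat A).toBlocks₁₁, (toMat A).toBlocks₂₂, ?_⟩
    conv_lhs => rw [← Matrix.fromBlocks_toBlocks (toMat A)]
    have h1 : (toMat A).toBlocks₁₂ = 0 := h.1
    have h2 : (toMat A).toBlocks₂₁ = 0 := h.2
    rw [h1, h2]
  · rintro ⟨X, Y, h⟩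
    change toMat A ∈ BlockDiagMat
    rw [h]
    exact ⟨Matrix.toBlocks_fromBlocks₁₂ .., Matrix.toBlocks_fromBlocks₂₁ ..⟩

theorem mem_tZero {A : BiSpinor} :
    A ∈ TZero ↔ ∃ X Y : Matrix (Fin 2) (Fin 2) ℂ, toMat A = Matrix.fromBlocks X 0 0 Y ∧
      X.trace = 0 ∧ Y.trace = 0 := by
  constructor
  · intro h
    obtain ⟨X, Y, e⟩ := mem_blockDiag.1 (show A ∈ BlockDiag from h.1)
    have h1 : (toMat A).toBlocks₁₁.trace = 0 := h.2.1
    have h2 : (toMat A).toBlocks₂₂.trace = 0 := h.2.2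
    rw [e, Matrix.toBlocks_fromBlocks₁₁] at h1
    rw [e, Matrix.toBlocks_fromBlocks₂₂] at h2
    exact ⟨X, Y, e, h1, h2⟩
  · rintro ⟨X, Y, h, h1, h2⟩
    refine ⟨mem_blockDiag.2 ⟨X, Y, h⟩, ?_, ?_⟩
    · change (toMat A).toBlocks₁₁.trace = 0
      rw [h, Matrix.toBlocks_fromBlocks₁₁, h1]
    · change (toMat A).toBlocks₂₂.trace = 0
      rw [h, Matrix.toBlocks_fromBlocks₂₂, h2]

theorem tZero_le_blockDiag : TZero ≤ BlockDiag := fun _ h => h.1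

theorem diracSymbol_mem_blockDiag (k : Space) {A : BiSpinor} (hA : A ∈ BlockDiag) :
    diracSymbol k A ∈ BlockDiag := by
  obtain ⟨X, Y, h⟩ := mem_blockDiag.1 hA
  refine mem_blockDiag.2 ⟨sigmaDot k * X, -sigmaDot k * Y, ?_⟩
  rw [toMat_diracSymbol, h, Matrix.fromBlocks_multiply]
  simp

theorem trace_sigmaDot (k : Space) : (sigmaDot k).trace = 0 := by
  simp [sigmaDot, Matrix.trace_fin_two]

/-- `α · k` maps block-diagonal bi-spinors orthogonal to `T₀` into `T₀`. -/
theorem diracSymbol_mem_tZero (k : Space) {A : BiSpinor} (hA : A ∈ BlockDiag)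
    (h : ∀ B ∈ TZero, inner ℂ B A = 0) : diracSymbol k A ∈ TZero := by
  obtain ⟨X, Y, e⟩ := mem_blockDiag.1 hA
  -- `C` is the block-scalar part of `A`, and `A - C` its trace-free part. Orthogonality to `T₀`
  -- leaves only `C`, and `α·k` times a block-scalar matrix has blocks proportional to the
  -- trace-free `σ·k`.
  let C : BiSpinor := toMat.symm (Matrix.fromBlocks ((X.trace / 2) • 1) 0 0 ((Y.trace / 2) • 1))
  have hC : toMat C = Matrix.fromBlocks ((X.trace / 2) • 1) 0 0 ((Y.trace / 2) • 1) :=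
    toMat.apply_symm_apply _
  have htr : ∀ Z : Matrix (Fin 2) (Fin 2) ℂ,
      (Z - (Z.trace / 2) • (1 : Matrix (Fin 2) (Fin 2) ℂ)).trace = 0 := by
    intro Z
    rw [Matrix.trace_sub, Matrix.trace_smul, Matrix.trace_one]
    simp
  have hAC : A - C ∈ TZero := by
    refine mem_tZero.2 ⟨X - (X.trace / 2) • 1, Y - (Y.trace / 2) • 1, ?_, htr X, htr Y⟩
    rw [map_sub, e, hC, sub_eq_add_neg, Matrix.fromBlocks_neg, Matrix.fromBlocks_add]
    simp [sub_eq_add_neg]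
  have hCo : inner ℂ (A - C) C = 0 := by
    obtain ⟨X', Y', e', h1, h2⟩ := mem_tZero.1 hAC
    have ht : ∀ M N : Matrix (Fin 2) (Fin 2) ℂ,
        (Matrix.fromBlocks M 0 0 N).trace = M.trace + N.trace := by
      intro M N
      simp [Matrix.trace, Fintype.sum_sum_type]
    rw [inner_def, e', hC, Matrix.fromBlocks_conjTranspose, Matrix.fromBlocks_multiply]
    simp [ht, Matrix.trace_conjTranspose, h1, h2]
  have h0 : A - C = 0 := by
    rw [← inner_self_eq_zero (𝕜 := ℂ), inner_sub_right, h _ hAC, hCo, sub_zero]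
  rw [sub_eq_zero.1 h0]
  refine mem_tZero.2 ⟨(X.trace / 2) • sigmaDot k, (Y.trace / 2) • (-sigmaDot k), ?_, ?_, ?_⟩
  · rw [toMat_diracSymbol, hC, Matrix.fromBlocks_multiply]
    simp
  · rw [Matrix.trace_smul, trace_sigmaDot, smul_zero]
  · rw [Matrix.trace_smul, Matrix.trace_neg, trace_sigmaDot, neg_zero, smul_zero]

/-- The divergence of a curl vanishes. -/
theorem diracSymbol_starProjection_mem_tZero (k : Space) {A : BiSpinor} (hA : A ∈ TZero) :
    diracSymbol k (TZero.starProjection (diracSymbol k A)) ∈ TZero := by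
  set B := diracSymbol k A with hB
  have h1 : B - TZero.starProjection B ∈ TZeroᗮ := Submodule.sub_starProjection_mem_orthogonal B
  have h2 : B - TZero.starProjection B ∈ BlockDiag :=
    BlockDiag.sub_mem (diracSymbol_mem_blockDiag k (tZero_le_blockDiag hA))
      (tZero_le_blockDiag (Submodule.starProjection_apply_mem _ _))
  have h3 := diracSymbol_mem_tZero k h2 fun C hC => (Submodule.mem_orthogonal _ _).1 h1 C hC
  -- `α·k B = |k|² A` is in `T₀`, and the discarded part of `B` is block-diagonal and orthogonal to
  -- `T₀`, so `α·k` sends it into `T₀` too.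
  have h4 : diracSymbol k (TZero.starProjection B) =
      ((‖k‖ ^ 2 : ℝ) : ℂ) • A - diracSymbol k (B - TZero.starProjection B) := by
    rw [map_sub, hB, diracSymbol_diracSymbol]
    abel
  rw [h4]
  exact TZero.sub_mem (TZero.smul_mem _ hA) h3

/-- The symbol of the compression of `H` to fields with values in `V`. -/
noncomputable def compressedSymbol (V : Submodule ℂ BiSpinor) (s : ℝ) (k : Space) :
    BiSpinor →L[ℂ] BiSpinor :=
  V.starProjection ∘L ((s : ℂ) • diracSymbol k) ∘L V.starProjection

theorem compressedSymbol_apply (V : Submodule ℂ BiSpinor) (s : ℝ) (k : Space) (A : BiSpinor) :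
    compressedSymbol V s k A = V.starProjection ((s : ℂ) • diracSymbol k (V.starProjection A)) :=
  rfl

theorem inner_compressedSymbol_left (V : Submodule ℂ BiSpinor) (s : ℝ) (k : Space)
    (A B : BiSpinor) :
    inner ℂ (compressedSymbol V s k A) B = inner ℂ A (compressedSymbol V s k B) := by
  simp only [compressedSymbol_apply]
  rw [Submodule.inner_starProjection_left_eq_right, inner_smul_left, inner_diracSymbol_left,
    Submodule.inner_starProjection_left_eq_right, map_smul, inner_smul_right, Complex.conj_ofReal]

/-- A symmetric operator has no non-real eigenvalue; both density proofs use this fact at almost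
every `k`. -/
theorem eq_zero_of_symmetric_of_apply_eq_smul {F : Type*} [NormedAddCommGroup F]
    [InnerProductSpace ℂ F] {h : F →L[ℂ] F}
    (hh : ∀ A B, inner ℂ (h A) B = inner ℂ A (h B)) {z : ℂ} (hz : z.im ≠ 0) {v : F}
    (hv : h v = z • v) : v = 0 := by
  have h1 := hh v v
  rw [hv, inner_smul_left, inner_smul_right, ← sub_eq_zero, ← sub_mul] at h1
  rcases mul_eq_zero.1 h1 with h2 | h2
  · exact absurd (Complex.conj_eq_iff_im.1 (sub_eq_zero.1 h2)) hz
  · exact inner_self_eq_zero.1 h2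

end PhotonHamiltonian

namespace PhotonHamiltonian

open scoped FourierTransform SchwartzMap

/-! ### Calculus of symbols -/

theorem eq_of_ft_eq {φ ψ : TestFields} (h : ∀ k, ft k φ = ft k ψ) : φ = ψ :=
  sub_eq_zero.1 (eq_zero_of_ft_eq_zero fun k => by rw [map_sub, h k, sub_self])

theorem mem_fieldsIn_iff_mapT {V : Submodule ℂ BiSpinor} {φ : TestFields} :
    φ ∈ fieldsIn V ↔ mapT V.starProjection φ = φ := by
  constructor
  · intro h
    exact Subtype.ext (funext fun x => Submodule.starProjection_eq_self_iff.2 (h x))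
  · intro h x
    rw [← h]
    exact Submodule.starProjection_apply_mem _ _

/-- Projection onto a constant fibre commutes with the Fourier transform, so fibre conditions can be
checked on the symbol side. -/
theorem mem_fieldsIn_iff_ft {V : Submodule ℂ BiSpinor} {φ : TestFields} :
    φ ∈ fieldsIn V ↔ ∀ k, ft k φ ∈ V := by
  rw [mem_fieldsIn_iff_mapT]
  constructor
  · intro h k
    rw [← h, ft_mapT]
    exact Submodule.starProjection_apply_mem _ _
  · intro h
    refine eq_of_ft_eq fun k => ?_
    rw [ft_mapT]
    exact Submodule.starProjection_eq_self_iff.2 (h k)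

theorem ft_hamiltonianT (ħ c : ℝ) (k : Space) (φ : TestFields) :
    ft k (hamiltonianT ħ c φ) = ((2 * Real.pi * ħ * c : ℝ) : ℂ) • diracSymbol k (ft k φ) := by
  have h1 : hamiltonianT ħ c φ =
      (-(Complex.I * ħ * c)) • ∑ j, mapT (leftMul (alpha j)) (partialT j φ) := by
    rw [hamiltonianT, LinearMap.smul_apply]
    congr 1
  have hI := Complex.I_sq
  rw [h1, map_smul, map_sum, diracSymbol, sum_apply, Finset.smul_sum, Finset.smul_sum]
  refine Finset.sum_congr rfl fun j _ => ?_
  rw [ft_mapT, ft_partialT, map_smul, smul_smul, smul_apply, smul_smul]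
  congr 1
  push_cast
  linear_combination (-2 * Real.pi * ħ * c * k j : ℂ) * hI

theorem ft_momentumT (ħ : ℝ) (j : Fin 3) (k : Space) (φ : TestFields) :
    ft k (momentumT ħ j φ) = ((2 * Real.pi * ħ * k j : ℝ) : ℂ) • ft k φ := by
  have hI := Complex.I_sq
  rw [momentumT, LinearMap.smul_apply, map_smul, ft_partialT, smul_smul]
  congr 1
  push_cast
  linear_combination (-2 * Real.pi * ħ * k j : ℂ) * hI

theorem ft_shift {S : TestFields →ₗ[ℂ] TestFields} {z : ℂ} (k : Space) (φ : TestFields) :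
    ft k (shift S z φ) = ft k (S φ) - z • ft k φ := by
  rw [shift_apply, map_sub, map_smul]

/-- The compression of `H` to fields with values in `V`. -/
noncomputable def compressedT (V : Submodule ℂ BiSpinor) (ħ c : ℝ) : TestFields →ₗ[ℂ] TestFields :=
  mapT V.starProjection ∘ₗ hamiltonianT ħ c ∘ₗ mapT V.starProjection

theorem ft_compressedT (V : Submodule ℂ BiSpinor) (ħ c : ℝ) (k : Space) (φ : TestFields) :
    ft k (compressedT V ħ c φ) = compressedSymbol V (2 * Real.pi * ħ * c) k (ft k φ) := by
  simp only [compressedT, LinearMap.comp_apply, ft_mapT, ft_hamiltonianT, compressedSymbol_apply]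

theorem compressedT_apply_of_mem {V : Submodule ℂ BiSpinor} {ħ c : ℝ} {φ : TestFields}
    (h : φ ∈ fieldsIn V) (h' : hamiltonianT ħ c φ ∈ fieldsIn V) :
    compressedT V ħ c φ = hamiltonianT ħ c φ := by
  rw [compressedT, LinearMap.comp_apply, LinearMap.comp_apply, mem_fieldsIn_iff_mapT.1 h,
    mem_fieldsIn_iff_mapT.1 h']

theorem inner_hamiltonianT_left (ħ c : ℝ) (φ ψ : TestFields) :
    inner ℂ (toL2 (hamiltonianT ħ c φ)) (toL2 ψ) =
      inner ℂ (toL2 φ) (toL2 (hamiltonianT ħ c ψ)) := by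
  refine inner_toL2_congr fun k => ?_
  rw [ft_hamiltonianT, ft_hamiltonianT, inner_smul_left, inner_smul_right, Complex.conj_ofReal,
    inner_diracSymbol_left]

theorem inner_momentumT_left (ħ : ℝ) (j : Fin 3) (φ ψ : TestFields) :
    inner ℂ (toL2 (momentumT ħ j φ)) (toL2 ψ) = inner ℂ (toL2 φ) (toL2 (momentumT ħ j ψ)) := by
  refine inner_toL2_congr fun k => ?_
  rw [ft_momentumT, ft_momentumT, inner_smul_left, inner_smul_right, Complex.conj_ofReal]

theorem inner_compressedT_left (V : Submodule ℂ BiSpinor) (ħ c : ℝ) (φ ψ : TestFields) :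
    inner ℂ (toL2 (compressedT V ħ c φ)) (toL2 ψ) =
      inner ℂ (toL2 φ) (toL2 (compressedT V ħ c ψ)) := by
  refine inner_toL2_congr fun k => ?_
  rw [ft_compressedT, ft_compressedT, inner_compressedSymbol_left]

theorem inner_mapT_left (V : Submodule ℂ BiSpinor) (φ ψ : TestFields) :
    inner ℂ (toL2 (mapT V.starProjection φ)) (toL2 ψ) =
      inner ℂ (toL2 φ) (toL2 (mapT V.starProjection ψ)) := by
  refine inner_toL2_congr fun k => ?_
  rw [ft_mapT, ft_mapT, Submodule.inner_starProjection_left_eq_right]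

theorem inner_hamiltonianT_eq_compressedT {V : Submodule ℂ BiSpinor} (ħ c : ℝ) {φ ψ : TestFields}
    (hφ : φ ∈ fieldsIn V) (hψ : ψ ∈ fieldsIn V) :
    inner ℂ (toL2 φ) (toL2 (hamiltonianT ħ c ψ)) =
      inner ℂ (toL2 φ) (toL2 (compressedT V ħ c ψ)) := by
  rw [compressedT, LinearMap.comp_apply, LinearMap.comp_apply, ← inner_mapT_left,
    mem_fieldsIn_iff_mapT.1 hφ, mem_fieldsIn_iff_mapT.1 hψ]

/-! ### Separation by test fields -/

/-- The test field `f A`. -/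
noncomputable def smulField {f : Space → ℝ} (hf : ContDiff ℝ ∞ f) (hc : HasCompactSupport f)
    (A : BiSpinor) : TestFields :=
  ⟨fun x => (f x : ℂ) • A, (Complex.ofRealCLM.contDiff.comp hf).smul contDiff_const,
    (hc.comp_left (g := ((↑) : ℝ → ℂ)) rfl).smul_right (f' := fun _ => A)⟩

theorem ft_smulField {f : Space → ℝ} (hf : ContDiff ℝ ∞ f) (hc : HasCompactSupport f)
    (A : BiSpinor) (k : Space) :
    ft k (smulField hf hc A) = (𝓕 (fun x => (f x : ℂ)) k) • A := by
  rw [ft_apply, Real.fourier_eq, Real.fourier_eq, ← integral_smul_const]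
  refine integral_congr_ae (Filter.Eventually.of_forall fun x => ?_)
  simp only [Circle.smul_def, smul_assoc]
  rfl

/-- A smooth bump around the origin with radius of order `1 / n`. -/
noncomputable def shrinkingBump (n : ℕ) : ContDiffBump (0 : Space) where
  rIn := 1 / (2 * ((n : ℝ) + 1))
  rOut := 1 / ((n : ℝ) + 1)
  rIn_pos := by positivity
  rIn_lt_rOut := by
    apply one_div_lt_one_div_of_lt <;> [positivity; linarith [(Nat.cast_nonneg n : (0 : ℝ) ≤ n)]]

/-- For `n > 4‖k‖` the support of the bump lies where `|x·k| < 1/4`. There `cos (2π x·k)` is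
positive, hence so is the real part of the transform at `k`. -/
theorem exists_fourier_shrinkingBump_ne_zero (k : Space) :
    ∃ n, 𝓕 (fun x => (shrinkingBump n x : ℂ)) k ≠ 0 := by
  obtain ⟨n, hn⟩ := exists_nat_gt (4 * ‖k‖)
  refine ⟨n, fun h0 => ?_⟩
  set f := shrinkingBump n with hf
  have hfc : Continuous fun x => f x := f.continuous
  have hfs : HasCompactSupport fun x => f x := f.hasCompactSupport
  have hint : Integrable fun x => (f x : ℂ) :=
    (hfc.integrable_of_hasCompactSupport hfs).ofReal
  have h1 : (𝓕 (fun x => (f x : ℂ)) k).re = ∫ x, Real.cos (2 * Real.pi * inner ℝ x k) * f x := by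
    rw [Real.fourier_eq, ← RCLike.re_eq_complex_re, ← integral_re]
    · refine integral_congr_ae (Filter.Eventually.of_forall fun x => ?_)
      simp only [Circle.smul_def, Real.fourierChar_apply, smul_eq_mul, RCLike.re_eq_complex_re,
        Complex.re_mul_ofReal, Complex.exp_ofReal_mul_I_re]
      rw [mul_neg, Real.cos_neg]
    · exact (Real.fourierIntegral_convergent_iff k).2 hint
  have hcos : ∀ x, f x ≠ 0 → 0 < Real.cos (2 * Real.pi * inner ℝ x k) := by
    intro x hx
    have hx' : ‖x‖ < 1 / ((n : ℝ) + 1) := by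
      have : x ∈ Function.support f := hx
      rw [f.support_eq, mem_ball_zero_iff] at this
      exact this
    have hxk : |inner ℝ x k| ≤ ‖x‖ * ‖k‖ := abs_real_inner_le_norm x k
    have hb : ‖x‖ * ‖k‖ < 1 / 4 := by
      have hn0 : (0 : ℝ) < (n : ℝ) + 1 := by positivity
      rw [lt_div_iff₀ hn0] at hx'
      nlinarith [norm_nonneg x, norm_nonneg k]
    have hlt := abs_lt.1 (hxk.trans_lt hb)
    have hpi := Real.pi_pos
    apply Real.cos_pos_of_mem_Ioo
    constructor <;> nlinarith
  have hpos : 0 < ∫ x, Real.cos (2 * Real.pi * inner ℝ x k) * f x := by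
    have hcont : Continuous fun x => Real.cos (2 * Real.pi * inner ℝ x k) * f x :=
      (Real.continuous_cos.comp (by fun_prop)).mul hfc
    refine hcont.integral_pos_of_hasCompactSupport_nonneg_nonzero (x := 0) hfs.mul_left ?_ ?_
    · intro x
      by_cases hx : f x = 0
      · simp [hx]
      · exact mul_nonneg (hcos x hx).le f.nonneg
    · have : f 0 = 1 := f.one_of_mem_closedBall (Metric.mem_closedBall_self f.rIn_pos.le)
      simp [this]
  rw [h0] at h1
  exact hpos.ne h1

/-- If `η` is orthogonal to the range of a multiplier, then its Fourier transform is orthogonal to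
the range of the symbol almost everywhere. -/
theorem ae_forall_inner_symbol_eq_zero {L : TestFields →ₗ[ℂ] TestFields}
    {σ : Space → BiSpinor →L[ℂ] BiSpinor} (hL : HasSymbol L σ) (η : L2Fields)
    (h : ∀ φ, inner ℂ (toL2 (L φ)) η = 0) :
    ∀ᵐ k, ∀ A, inner ℂ (σ k A) ((𝓕 η : L2Fields) k) = 0 := by
  let b := Module.finBasis ℂ BiSpinor
  -- The exceptional null set must not depend on `A`. Countably many fields suffice: basis vectors
  -- times bumps, one of which has non-zero transform at the given `k`.
  have h1 : ∀ᵐ k, ∀ (i : Fin (Module.finrank ℂ BiSpinor)) (n : ℕ),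
      inner ℂ (σ k (ft k (smulField (shrinkingBump n).contDiff (shrinkingBump n).hasCompactSupport
        (b i)))) ((𝓕 η : L2Fields) k) = 0 :=
    ae_all_iff.2 fun i => ae_all_iff.2 fun n =>
      ae_inner_symbol_eq_zero hL η _ fun a => h _
  filter_upwards [h1] with k hk A
  have hb : ∀ i, inner ℂ (σ k (b i)) ((𝓕 η : L2Fields) k) = 0 := by
    intro i
    obtain ⟨n, hn⟩ := exists_fourier_shrinkingBump_ne_zero k
    have := hk i n
    rw [ft_smulField, map_smul, inner_smul_left] at this
    exact (mul_eq_zero.1 this).resolve_left ((map_ne_zero _).2 hn)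
  rw [← b.sum_repr A, map_sum, sum_inner]
  refine Finset.sum_eq_zero fun i _ => ?_
  rw [map_smul, inner_smul_left, hb i, mul_zero]

theorem eq_zero_of_fourier_ae_eq_zero {η : L2Fields} (h : ∀ᵐ k, (𝓕 η : L2Fields) k = 0) :
    η = 0 := by
  have h1 : (𝓕 η : L2Fields) = 0 := (Lp.eq_zero_iff_ae_eq_zero).2 h
  rw [← norm_eq_zero, ← Lp.norm_fourier_eq, h1, norm_zero]

end PhotonHamiltonian

namespace PhotonHamiltonian

open scoped FourierTransform SchwartzMap

/-! ### The three pairs of commuting operators -/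

theorem inner_starProjection_compl_eq_zero {V : Submodule ℂ BiSpinor} {φ ψ : TestFields}
    (hψ : ψ ∈ fieldsIn V) :
    inner ℂ (toL2 (φ - mapT V.starProjection φ)) (toL2 ψ) = 0 := by
  rw [map_sub, inner_sub_left, inner_mapT_left, mem_fieldsIn_iff_mapT.1 hψ, sub_self]

/-- The Fourier transform of an element of the completion of a space of `V`-valued fields is
`V`-valued. -/
theorem ae_starProjection_fourier_eq {V : Submodule ℂ BiSpinor} {D : Submodule ℂ TestFields}
    (hD : D ≤ fieldsIn V) {η : L2Fields} (hη : η ∈ completion D) :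
    ∀ᵐ k, V.starProjection ((𝓕 η : L2Fields) k) = (𝓕 η : L2Fields) k := by
  -- `η` is orthogonal to the range of `1 - P_V`, a multiplier with constant symbol; hence its
  -- transform takes values in `V`.
  have h1 : HasSymbol (LinearMap.id - mapT V.starProjection)
      (fun _ => ContinuousLinearMap.id ℂ BiSpinor - V.starProjection) := by
    intro φ k
    rw [LinearMap.sub_apply, map_sub, ft_mapT]
    rfl
  have h2 := ae_forall_inner_symbol_eq_zero h1 η fun φ => by
    rw [← inner_conj_symm, inner_eq_zero_of_mem_completion (D := D) ?_ hη, map_zero]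
    intro ψ hψ
    rw [← inner_conj_symm]
    exact (map_eq_zero _).2 (inner_starProjection_compl_eq_zero (hD hψ))
  filter_upwards [h2] with k hk
  set v := (𝓕 η : L2Fields) k
  have h3 : inner ℂ (v - V.starProjection v) (v - V.starProjection v) = 0 := by
    have h4 : inner ℂ (v - V.starProjection v) v = 0 := hk v
    rw [inner_sub_right, h4, zero_sub, neg_eq_zero]
    exact Submodule.inner_left_of_mem_orthogonal (Submodule.starProjection_apply_mem _ _)
      (Submodule.sub_starProjection_mem_orthogonal v)
  exact (sub_eq_zero.1 (inner_self_eq_zero.1 h3)).symm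

theorem hasSymbol_shift_shift_comp (V : Submodule ℂ BiSpinor) (ħ c : ℝ) (j : Fin 3) (z w : ℂ)
    {L : TestFields →ₗ[ℂ] TestFields} {σ : Space → BiSpinor →L[ℂ] BiSpinor} (hL : HasSymbol L σ) :
    HasSymbol (shift (compressedT V ħ c) z ∘ₗ shift (momentumT ħ j) w ∘ₗ L)
      fun k => (((2 * Real.pi * ħ * k j : ℝ) : ℂ) - w) •
        (compressedSymbol V (2 * Real.pi * ħ * c) k - z • ContinuousLinearMap.id ℂ BiSpinor) ∘L
          σ k := by
  intro φ k
  simp only [LinearMap.comp_apply]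
  rw [ft_shift, ft_compressedT, ft_shift, ft_momentumT, hL φ k, ← sub_smul, map_smul,
    smul_comm z, ← smul_sub]
  rfl

theorem compressedT_momentumT (V : Submodule ℂ BiSpinor) (ħ c : ℝ) (j : Fin 3) (φ : TestFields) :
    compressedT V ħ c (momentumT ħ j φ) = momentumT ħ j (compressedT V ħ c φ) :=
  eq_of_ft_eq fun k => by
    rw [ft_compressedT, ft_momentumT, ft_momentumT, ft_compressedT, map_smul]

/-- Orthogonality to the shifted range of a compression, on the Fourier side. -/
theorem ae_symbol_fourier_eq {V : Submodule ℂ BiSpinor} {ħ c : ℝ} {j : Fin 3} {z w : ℂ}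
    (hw : w.im ≠ 0) {L : TestFields →ₗ[ℂ] TestFields} {σ : Space → BiSpinor →L[ℂ] BiSpinor}
    (hL : HasSymbol L σ) (hσ : ∀ k A B, inner ℂ (σ k A) B = inner ℂ A (σ k B)) {η : L2Fields}
    (h : ∀ φ, inner ℂ (toL2 (shift (compressedT V ħ c) z (shift (momentumT ħ j) w (L φ)))) η = 0) :
    ∀ᵐ k, σ k (compressedSymbol V (2 * Real.pi * ħ * c) k ((𝓕 η : L2Fields) k)) =
      (starRingEnd ℂ z) • σ k ((𝓕 η : L2Fields) k) := by
  filter_upwards [ae_forall_inner_symbol_eq_zero (hasSymbol_shift_shift_comp V ħ c j z w hL) η h]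
    with k hk
  set v := (𝓕 η : L2Fields) k
  set a := compressedSymbol V (2 * Real.pi * ħ * c) k
  -- The momentum symbol is real and `w` is not, so this scalar factor never vanishes and can be
  -- cancelled.
  have hw' : ((2 * Real.pi * ħ * k j : ℝ) : ℂ) - w ≠ 0 := by
    intro h0
    refine hw ?_
    rw [← sub_eq_zero.1 h0]
    exact Complex.ofReal_im _
  have h1 : ∀ A, inner ℂ A (σ k (a v) - (starRingEnd ℂ z) • σ k v) = 0 := by
    intro A
    have h2 : inner ℂ ((((2 * Real.pi * ħ * k j : ℝ) : ℂ) - w) • (a (σ k A) - z • σ k A)) v = 0 :=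
      hk A
    rw [inner_smul_left] at h2
    have h3 := (mul_eq_zero.1 h2).resolve_left ((map_ne_zero _).2 hw')
    rwa [inner_sub_left, inner_smul_left, inner_compressedSymbol_left, hσ, hσ, ← inner_smul_right,
      ← inner_sub_right] at h3
  exact sub_eq_zero.1 (inner_self_eq_zero.1 (h1 _))

theorem isCommutingPair_fieldsIn (V : Submodule ℂ BiSpinor) (ħ c : ℝ) (j : Fin 3) :
    IsCommutingPair (fieldsIn V) (compressedT V ħ c) (momentumT ħ j) where
  mapsTo_left φ _ x := Submodule.starProjection_apply_mem _ _
  mapsTo_right φ hφ := by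
    rw [mem_fieldsIn_iff_ft] at hφ ⊢
    intro k
    rw [ft_momentumT]
    exact V.smul_mem _ (hφ k)
  symm_left φ _ ψ _ := inner_compressedT_left V ħ c φ ψ
  symm_right φ _ ψ _ := inner_momentumT_left ħ j φ ψ
  comm φ _ := compressedT_momentumT V ħ c j φ
  dense z w hz hw η hη h := by
    -- Projecting arbitrary test fields onto `V` supplies enough elements of the domain. As the
    -- transform `v` of `η` is `V`-valued, the result is `h v = z̄ v` for the compressed symbol `h`.
    have hs : HasSymbol (mapT V.starProjection) fun _ => V.starProjection := fun φ k => ft_mapT k _ φ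
    have h1 := ae_symbol_fourier_eq hw hs
      (fun k A B => Submodule.inner_starProjection_left_eq_right V A B) fun φ =>
        h (mapT V.starProjection φ) fun x => Submodule.starProjection_apply_mem _ _
    refine eq_zero_of_fourier_ae_eq_zero ?_
    filter_upwards [h1, ae_starProjection_fourier_eq le_rfl hη] with k hk1 hk2
    rw [hk2] at hk1
    refine eq_zero_of_symmetric_of_apply_eq_smul (z := starRingEnd ℂ z)
      (inner_compressedSymbol_left V (2 * Real.pi * ħ * c) k) (by simpa using hz) ?_
    rw [← hk1, compressedSymbol_apply]
    exact (Submodule.starProjection_eq_self_iff.2 (Submodule.starProjection_apply_mem _ _)).symm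

theorem mem_transversalFields {ħ c : ℝ} {φ : TestFields} :
    φ ∈ TransversalFields ħ c ↔ φ ∈ fieldsIn TZero ∧ hamiltonianT ħ c φ ∈ fieldsIn TZero := Iff.rfl

/-- `H²` acts on the Fourier side as a scalar, so `H (H φ)` stays `T₀`-valued. -/
theorem hamiltonianT_mem_transversalFields {ħ c : ℝ} {φ : TestFields}
    (hφ : φ ∈ TransversalFields ħ c) : hamiltonianT ħ c φ ∈ TransversalFields ħ c := by
  refine mem_transversalFields.2 ⟨hφ.2, mem_fieldsIn_iff_ft.2 fun k => ?_⟩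
  rw [ft_hamiltonianT, ft_hamiltonianT, map_smul, diracSymbol_diracSymbol]
  exact TZero.smul_mem _ (TZero.smul_mem _ (TZero.smul_mem _ (mem_fieldsIn_iff_ft.1 hφ.1 k)))

theorem compressedT_eq_of_mem_transversalFields {ħ c : ℝ} {φ : TestFields}
    (hφ : φ ∈ TransversalFields ħ c) : compressedT TZero ħ c φ = hamiltonianT ħ c φ :=
  compressedT_apply_of_mem hφ.1 hφ.2

theorem compressedT_mem_transversalFields (ħ c : ℝ) (φ : TestFields) :
    compressedT TZero ħ c φ ∈ TransversalFields ħ c := by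
  refine mem_transversalFields.2 ⟨fun x => Submodule.starProjection_apply_mem _ _,
    mem_fieldsIn_iff_ft.2 fun k => ?_⟩
  rw [ft_hamiltonianT, ft_compressedT, compressedSymbol_apply, map_smul, map_smul]
  exact TZero.smul_mem _ (TZero.smul_mem _ (diracSymbol_starProjection_mem_tZero k
    (Submodule.starProjection_apply_mem _ _)))

/-- The Fourier transform of an element of the completion of the transversal fields is
transversal. -/
theorem ae_diracSymbol_fourier_mem {ħ c : ℝ} (hħ : ħ ≠ 0) (hc : c ≠ 0) {η : L2Fields}
    (hη : η ∈ completion (TransversalFields ħ c)) :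
    ∀ᵐ k, TZero.starProjection (diracSymbol k ((𝓕 η : L2Fields) k)) =
      diracSymbol k ((𝓕 η : L2Fields) k) := by
  -- For transversal `ψ`, `H ψ` is `T₀`-valued and so orthogonal to every `(1 - P)φ`, where `P`
  -- projects onto `T₀`. Moving `H` across makes `ψ`, and in the limit `η`, orthogonal to the range
  -- of `H (1 - P)`.
  have h1 : HasSymbol (hamiltonianT ħ c ∘ₗ (LinearMap.id - mapT TZero.starProjection))
      (fun k => (((2 * Real.pi * ħ * c : ℝ) : ℂ) • diracSymbol k) ∘L
        (ContinuousLinearMap.id ℂ BiSpinor - TZero.starProjection)) := by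
    intro φ k
    rw [LinearMap.comp_apply, ft_hamiltonianT, LinearMap.sub_apply, map_sub, ft_mapT]
    rfl
  have h2 := ae_forall_inner_symbol_eq_zero h1 η fun φ => by
    rw [← inner_conj_symm,
      inner_eq_zero_of_mem_completion (D := TransversalFields ħ c) ?_ hη, map_zero]
    intro ψ hψ
    rw [← inner_conj_symm, LinearMap.comp_apply, inner_hamiltonianT_left]
    exact (map_eq_zero _).2 (inner_starProjection_compl_eq_zero hψ.2)
  filter_upwards [h2] with k hk
  set v := (𝓕 η : L2Fields) k
  have hs : ((2 * Real.pi * ħ * c : ℝ) : ℂ) ≠ 0 := by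
    have := Real.pi_ne_zero
    exact Complex.ofReal_ne_zero.2 (by positivity)
  have h3 : ∀ A, inner ℂ (A - TZero.starProjection A) (diracSymbol k v) = 0 := by
    intro A
    have h4 : inner ℂ (((2 * Real.pi * ħ * c : ℝ) : ℂ) •
        diracSymbol k (A - TZero.starProjection A)) v = 0 := hk A
    rw [inner_smul_left, inner_diracSymbol_left] at h4
    exact (mul_eq_zero.1 h4).resolve_left ((map_ne_zero _).2 hs)
  have h5 := h3 (diracSymbol k v)
  have h6 : inner ℂ (diracSymbol k v - TZero.starProjection (diracSymbol k v))
      (diracSymbol k v - TZero.starProjection (diracSymbol k v)) = 0 := by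
    rw [inner_sub_right, h5, zero_sub, neg_eq_zero]
    exact Submodule.inner_left_of_mem_orthogonal (Submodule.starProjection_apply_mem _ _)
      (Submodule.sub_starProjection_mem_orthogonal _)
  exact (sub_eq_zero.1 (inner_self_eq_zero.1 h6)).symm

theorem isCommutingPair_transversalFields {ħ c : ℝ} (hħ : ħ ≠ 0) (hc : c ≠ 0) (j : Fin 3) :
    IsCommutingPair (TransversalFields ħ c) (compressedT TZero ħ c) (momentumT ħ j) where
  mapsTo_left φ _ := compressedT_mem_transversalFields ħ c φ
  mapsTo_right φ hφ := by
    refine mem_transversalFields.2 ⟨mem_fieldsIn_iff_ft.2 fun k => ?_,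
      mem_fieldsIn_iff_ft.2 fun k => ?_⟩
    · rw [ft_momentumT]
      exact TZero.smul_mem _ (mem_fieldsIn_iff_ft.1 hφ.1 k)
    · rw [ft_hamiltonianT, ft_momentumT, map_smul, smul_comm, ← ft_hamiltonianT]
      exact TZero.smul_mem _ (mem_fieldsIn_iff_ft.1 hφ.2 k)
  symm_left φ _ ψ _ := inner_compressedT_left TZero ħ c φ ψ
  symm_right φ _ ψ _ := inner_momentumT_left ħ j φ ψ
  comm φ _ := compressedT_momentumT TZero ħ c j φ
  dense z w hz hw η hη h := by
    -- A projected field need not be transversal, so test fields are fed through the compression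
    -- instead, whose range is transversal. With `h` the compressed symbol and `v` the transform of
    -- `η`, this gives `h (h v) = z̄ h v`, hence `h v = 0`. Transversality turns this into `α·k v =
    -- 0`, and squaring gives `v = 0` off the null set `k = 0`.
    have hs : HasSymbol (compressedT TZero ħ c)
        fun k => compressedSymbol TZero (2 * Real.pi * ħ * c) k :=
      fun φ k => ft_compressedT TZero ħ c k φ
    have h1 := ae_symbol_fourier_eq hw hs
      (fun k A B => inner_compressedSymbol_left TZero _ k A B) fun φ =>
        h (compressedT TZero ħ c φ) (compressedT_mem_transversalFields ħ c φ)
    have h0 : ∀ᵐ k : Space, k ≠ 0 := by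
      simp [ae_iff, measure_singleton]
    refine eq_zero_of_fourier_ae_eq_zero ?_
    filter_upwards [h1, ae_starProjection_fourier_eq (V := TZero) inf_le_left hη,
      ae_diracSymbol_fourier_mem hħ hc hη, h0] with k hk1 hk2 hk3 hk4
    have h2 := eq_zero_of_symmetric_of_apply_eq_smul (z := starRingEnd ℂ z)
      (inner_compressedSymbol_left TZero (2 * Real.pi * ħ * c) k) (by simpa using hz) hk1
    rw [compressedSymbol_apply, hk2, map_smul, hk3] at h2
    have hr : ((2 * Real.pi * ħ * c : ℝ) : ℂ) ≠ 0 := by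
      have := Real.pi_ne_zero
      exact Complex.ofReal_ne_zero.2 (by positivity)
    have h3 := (smul_eq_zero.1 h2).resolve_left hr
    have h4 := diracSymbol_diracSymbol k ((𝓕 η : L2Fields) k)
    rw [h3, map_zero] at h4
    refine (smul_eq_zero.1 h4.symm).resolve_left (Complex.ofReal_ne_zero.2 ?_)
    exact pow_ne_zero _ (norm_ne_zero_iff.2 hk4)

end PhotonHamiltonian

namespace PhotonHamiltonian

open scoped Topology

/-! ### Helicity eigenvectors -/

/-- The full matrix algebra is prime: a matrix unit joins a non-zero entry of `X` to one of `Y`. -/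
theorem exists_mul_mul_ne_zero {X Y : Matrix (Fin 2) (Fin 2) ℂ} (hX : X ≠ 0) (hY : Y ≠ 0) :
    ∃ M : Matrix (Fin 2) (Fin 2) ℂ, X * M * Y ≠ 0 := by
  by_contra! h
  obtain ⟨i, j, hij⟩ : ∃ i j, X i j ≠ 0 := by
    by_contra! h'
    exact hX (Matrix.ext h')
  obtain ⟨k, l, hkl⟩ : ∃ k l, Y k l ≠ 0 := by
    by_contra! h'
    exact hY (Matrix.ext h')
  have h1 := congrFun (congrFun (h (Matrix.single j k 1)) i) l
  rw [Matrix.mul_assoc, Matrix.mul_apply] at h1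
  simp only [Matrix.mul_apply, Matrix.single_apply, Matrix.zero_apply] at h1
  rw [Finset.sum_eq_single j, Finset.sum_eq_single k] at h1
  · simp [hij, hkl] at h1
  · intro b _ hb; simp [hb.symm]
  · simp
  · intro b _ hb; simp [hb.symm]
  · simp

/-- Trace-free matrices of positive helicity. -/
theorem exists_sigmaDot_mul_eq (k : Space) :
    ∃ X : Matrix (Fin 2) (Fin 2) ℂ, X ≠ 0 ∧ X.trace = 0 ∧ sigmaDot k * X = (‖k‖ : ℂ) • X := by
  have hsq : sigmaDot k * sigmaDot k = ((‖k‖ : ℂ) * ‖k‖) • 1 := by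
    rw [sigmaDot_mul_self]; push_cast; rw [sq]
  by_cases hk : k = 0
  · refine ⟨Matrix.single 0 1 1, ?_, ?_, ?_⟩
    · intro h
      have := congrFun (congrFun h 0) 1
      simp at this
    · simp
    · have : sigmaDot k = 0 := by
        ext i j
        fin_cases i <;> fin_cases j <;> simp [sigmaDot, hk]
      rw [this, hk]
      simp
  · have hn : (‖k‖ : ℂ) ≠ 0 := Complex.ofReal_ne_zero.2 (norm_ne_zero_iff.2 hk)
    have hne : ∀ s : ℂ, ((‖k‖ : ℂ) • (1 : Matrix (Fin 2) (Fin 2) ℂ) + s • sigmaDot k) ≠ 0 := by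
      intro s h
      have := congrArg Matrix.trace h
      rw [Matrix.trace_add, Matrix.trace_smul, Matrix.trace_smul, trace_sigmaDot, Matrix.trace_one]
        at this
      simp at this
      exact hk this
    -- The witness is `(|k| + σ·k) M (|k| - σ·k)`. The left factor makes it an eigenvector;
    -- cyclicity of the trace brings the outer factors together, where their product vanishes.
    obtain ⟨M, hM⟩ := exists_mul_mul_ne_zero (hne 1) (hne (-1))
    refine ⟨_, hM, ?_, ?_⟩
    · rw [Matrix.mul_assoc, Matrix.trace_mul_comm, Matrix.mul_assoc]
      have : ((‖k‖ : ℂ) • (1 : Matrix (Fin 2) (Fin 2) ℂ) + (-1 : ℂ) • sigmaDot k) *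
          ((‖k‖ : ℂ) • 1 + (1 : ℂ) • sigmaDot k) = 0 := by
        simp only [Matrix.add_mul, Matrix.mul_add, Matrix.smul_mul, Matrix.mul_smul, hsq,
          Matrix.one_mul, Matrix.mul_one]
        module
      rw [this, Matrix.mul_zero, Matrix.trace_zero]
    · rw [← Matrix.mul_assoc, ← Matrix.mul_assoc]
      have : sigmaDot k * ((‖k‖ : ℂ) • (1 : Matrix (Fin 2) (Fin 2) ℂ) + (1 : ℂ) • sigmaDot k) =
          (‖k‖ : ℂ) • ((‖k‖ : ℂ) • 1 + (1 : ℂ) • sigmaDot k) := by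
        simp only [Matrix.mul_add, Matrix.mul_smul, hsq, Matrix.mul_one]
        module
      rw [this, Matrix.smul_mul, Matrix.smul_mul]

theorem exists_diracSymbol_eq_norm (k : Space) :
    ∃ A ∈ TZero, A ≠ 0 ∧ diracSymbol k A = (‖k‖ : ℂ) • A := by
  obtain ⟨X, h0, h1, h2⟩ := exists_sigmaDot_mul_eq k
  have hA : toMat (toMat.symm (Matrix.fromBlocks X 0 0 0)) = Matrix.fromBlocks X 0 0 0 :=
    toMat.apply_symm_apply _
  refine ⟨toMat.symm (Matrix.fromBlocks X 0 0 0),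
    mem_tZero.2 ⟨X, 0, hA, h1, Matrix.trace_zero _ _⟩, ?_, toMat.injective ?_⟩
  · rw [ne_eq, LinearEquiv.map_eq_zero_iff]
    intro h
    exact h0 (by rw [← Matrix.toBlocks_fromBlocks₁₁ X 0 0 (0 : Matrix (Fin 2) (Fin 2) ℂ), h]; rfl)
  · rw [toMat_diracSymbol, map_smul, hA, Matrix.fromBlocks_multiply, Matrix.fromBlocks_smul]
    simp [h2]

/-- The positive-helicity `X` goes into the lower block, where `α·k` acts as `-σ·k`. -/
theorem exists_diracSymbol_eq_neg_norm (k : Space) :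
    ∃ A ∈ TZero, A ≠ 0 ∧ diracSymbol k A = (-‖k‖ : ℂ) • A := by
  obtain ⟨X, h0, h1, h2⟩ := exists_sigmaDot_mul_eq k
  have hA : toMat (toMat.symm (Matrix.fromBlocks 0 0 0 X)) = Matrix.fromBlocks 0 0 0 X :=
    toMat.apply_symm_apply _
  refine ⟨toMat.symm (Matrix.fromBlocks 0 0 0 X),
    mem_tZero.2 ⟨0, X, hA, Matrix.trace_zero _ _, h1⟩, ?_, toMat.injective ?_⟩
  · rw [ne_eq, LinearEquiv.map_eq_zero_iff]
    intro h
    exact h0 (by rw [← Matrix.toBlocks_fromBlocks₂₂ (0 : Matrix (Fin 2) (Fin 2) ℂ) 0 0 X, h]; rfl)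
  · rw [toMat_diracSymbol, map_smul, hA, Matrix.fromBlocks_multiply, Matrix.fromBlocks_smul]
    simp [h2]

/-! ### Modulated and dilated fields -/

/-- The phase `e^{i k·x}`. -/
noncomputable def phase (k x : Space) : ℂ := Complex.exp (Complex.I * (inner ℝ k x : ℝ))

theorem phase_contDiff (k : Space) : ContDiff ℝ ∞ (phase k) := by
  refine Complex.contDiff_exp.comp (contDiff_const.mul ?_)
  exact Complex.ofRealCLM.contDiff.comp (innerSL ℝ k).contDiff

theorem norm_phase (k x : Space) : ‖phase k x‖ = 1 := by
  rw [phase, mul_comm, Complex.norm_exp_ofReal_mul_I]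

theorem phase_ne_zero (k x : Space) : phase k x ≠ 0 := Complex.exp_ne_zero _

theorem hasFDerivAt_phase (k x : Space) :
    HasFDerivAt (phase k)
      (phase k x • (Complex.I • (Complex.ofRealCLM ∘L (innerSL ℝ k)))) x := by
  have h1 : HasFDerivAt (fun x : Space => ((inner ℝ k x : ℝ) : ℂ))
      (Complex.ofRealCLM ∘L (innerSL ℝ k)) x := (Complex.ofRealCLM ∘L (innerSL ℝ k)).hasFDerivAt
  exact (h1.const_mul Complex.I).cexp

theorem partialD_phase_smul (k : Space) (j : Fin 3) {f : Space → BiSpinor} {x : Space}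
    (hf : DifferentiableAt ℝ f x) :
    partialD j (fun x => phase k x • f x) x =
      phase k x • (partialD j f x + (Complex.I * k j) • f x) := by
  have h := ((hasFDerivAt_phase k x).smul hf.hasFDerivAt).fderiv
  change fderiv ℝ (fun x => phase k x • f x) x _ = _
  rw [show (fun x => phase k x • f x) = phase k • f from rfl, h]
  simp only [add_apply, smul_apply, ContinuousLinearMap.smulRight_apply,
    ContinuousLinearMap.comp_apply, innerSL_apply_apply, EuclideanSpace.inner_single_right]
  simp [partialD, smul_smul]

theorem hamiltonian_phase_smul (ħ c : ℝ) (k : Space) {f : Space → BiSpinor} {x : Space}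
    (hf : DifferentiableAt ℝ f x) :
    hamiltonian ħ c (fun x => phase k x • f x) x =
      phase k x • (hamiltonian ħ c f x + ((ħ * c : ℝ) : ℂ) • diracSymbol k (f x)) := by
  have hI := Complex.I_sq
  simp only [hamiltonian, partialD_phase_smul k _ hf, map_smul, map_add, ← Finset.smul_sum,
    Finset.sum_add_distrib, diracSymbol, sum_apply, smul_apply, mul_smul Complex.I]
  rw [smul_comm, smul_add, smul_add, smul_add, smul_smul _ Complex.I]
  congr 3
  push_cast
  linear_combination (-(ħ : ℂ) * c) * hI

theorem partialD_comp_smul (ε : ℝ) (j : Fin 3) {f : Space → BiSpinor} (hf : Differentiable ℝ f)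
    (x : Space) : partialD j (fun x => f (ε • x)) x = (ε : ℂ) • partialD j f (ε • x) := by
  have h1 : HasFDerivAt (fun x : Space => ε • x) (ε • ContinuousLinearMap.id ℝ Space) x :=
    (hasFDerivAt_id x).const_smul ε
  have h2 := ((hf (ε • x)).hasFDerivAt.comp x h1).fderiv
  change fderiv ℝ (f ∘ fun x => ε • x) x _ = _
  rw [h2, Complex.coe_smul]
  simp [partialD]

theorem hamiltonian_comp_smul (ħ c ε : ℝ) {f : Space → BiSpinor} (hf : Differentiable ℝ f)
    (x : Space) :
    hamiltonian ħ c (fun x => f (ε • x)) x = (ε : ℂ) • hamiltonian ħ c f (ε • x) := by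
  simp only [hamiltonian, partialD_comp_smul ε _ hf, map_smul, ← Finset.smul_sum]
  rw [smul_comm]

/-- The field `e^{i k·x} φ(ε x)`. -/
noncomputable def modulate (k : Space) {ε : ℝ} (hε : ε ≠ 0) : TestFields →ₗ[ℂ] TestFields where
  toFun φ := ⟨fun x => phase k x • φ.1 (ε • x),
    (phase_contDiff k).smul (φ.2.1.comp (contDiff_const_smul ε)),
    (φ.2.2.comp_homeomorph (Homeomorph.smulOfNeZero ε hε)).smul_left (f := phase k)⟩
  map_add' φ ψ := by ext1; funext x; exact smul_add _ _ _
  map_smul' r φ := by ext1; funext x; exact smul_comm _ r _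

theorem modulate_apply (k : Space) {ε : ℝ} (hε : ε ≠ 0) (φ : TestFields) (x : Space) :
    (modulate k hε φ).1 x = phase k x • φ.1 (ε • x) := rfl

theorem mapT_modulate (l : BiSpinor →L[ℂ] BiSpinor) (k : Space) {ε : ℝ} (hε : ε ≠ 0)
    (φ : TestFields) : mapT l (modulate k hε φ) = modulate k hε (mapT l φ) :=
  Subtype.ext (funext fun _ => map_smul l _ _)

theorem hamiltonianT_modulate (ħ c : ℝ) (k : Space) {ε : ℝ} (hε : ε ≠ 0) (φ : TestFields) :
    hamiltonianT ħ c (modulate k hε φ) = modulate k hε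
      ((ε : ℂ) • hamiltonianT ħ c φ + ((ħ * c : ℝ) : ℂ) • mapT (diracSymbol k) φ) := by
  refine Subtype.ext (funext fun x => ?_)
  have hd := testFields_differentiable φ
  have hd' : DifferentiableAt ℝ (fun x => φ.1 (ε • x)) x := by fun_prop
  rw [hamiltonianT_coe]
  refine (hamiltonian_phase_smul ħ c k hd').trans ?_
  rw [hamiltonian_comp_smul ħ c ε hd, ← hamiltonianT_coe]
  rfl

/-- The phase is unimodular and the dilation rescales volume. Since `C` does not depend on `φ`, it
cancels from the approximate eigenvalue estimate. -/
theorem norm_toL2_modulate (k : Space) {ε : ℝ} (hε : ε ≠ 0) :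
    ∃ C : ℝ, 0 < C ∧ ∀ φ, ‖toL2 (modulate k hε φ)‖ = C * ‖toL2 φ‖ := by
  set C := |(ε ^ Module.finrank ℝ Space)⁻¹| with hC
  have hC0 : 0 < C := abs_pos.2 (inv_ne_zero (pow_ne_zero _ hε))
  refine ⟨Real.sqrt C, Real.sqrt_pos.2 hC0, fun φ => ?_⟩
  have h1 : inner ℂ (toL2 (modulate k hε φ)) (toL2 (modulate k hε φ)) =
      C • inner ℂ (toL2 φ) (toL2 φ) := by
    rw [inner_toL2, inner_toL2, hC, ← Measure.integral_comp_smul]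
    refine integral_congr_ae (Filter.Eventually.of_forall fun x => ?_)
    change inner ℂ ((modulate k hε φ).1 x) ((modulate k hε φ).1 x) =
      inner ℂ (φ.1 (ε • x)) (φ.1 (ε • x))
    rw [modulate_apply, inner_smul_left, inner_smul_right, ← mul_assoc, mul_comm (starRingEnd ℂ _),
      Complex.mul_conj, Complex.normSq_eq_norm_sq, norm_phase]
    simp
  have h2 : ‖toL2 (modulate k hε φ)‖ ^ 2 = C * ‖toL2 φ‖ ^ 2 := by
    rw [inner_self_eq_norm_sq_to_K, inner_self_eq_norm_sq_to_K, Complex.real_smul] at h1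
    simp only [Complex.coe_algebraMap] at h1
    exact_mod_cast h1
  rw [← Real.sqrt_sq (norm_nonneg (toL2 (modulate k hε φ))), h2, Real.sqrt_mul hC0.le,
    Real.sqrt_sq (norm_nonneg _)]

/-- Approximate eigenvectors of `H` among the transversal fields. -/
theorem exists_approximate_eigenvector {ħ c : ℝ} (hħ : 0 < ħ) (hc : 0 < c) (l : ℝ) (hl : l ≠ 0)
    (δ : ℝ) (hδ : 0 < δ) : ∃ φ ∈ TransversalFields ħ c,
      ‖toL2 (hamiltonianT ħ c φ - (l : ℂ) • φ)‖ < δ * ‖toL2 φ‖ := by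
  -- The wave vector has length `|l| / (ħc)`; the sign of `l` selects the helicity of the amplitude.
  obtain ⟨k, A, hA, hA0, hAk⟩ : ∃ (k : Space), ∃ A ∈ TZero, A ≠ 0 ∧
      ((ħ * c : ℝ) : ℂ) • diracSymbol k A = (l : ℂ) • A := by
    have hk : ‖(EuclideanSpace.single (0 : Fin 3) (l / (ħ * c)) : Space)‖ = |l| / (ħ * c) := by
      rw [PiLp.norm_single, Real.norm_eq_abs, abs_div, abs_of_pos (mul_pos hħ hc)]
    have hne : ħ * c ≠ 0 := (mul_pos hħ hc).ne'
    rcases le_or_gt 0 l with h | h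
    · obtain ⟨A, h1, h2, h3⟩ := exists_diracSymbol_eq_norm
        (EuclideanSpace.single (0 : Fin 3) (l / (ħ * c)) : Space)
      refine ⟨EuclideanSpace.single (0 : Fin 3) (l / (ħ * c)), A, h1, h2, ?_⟩
      rw [h3, hk, smul_smul, abs_of_nonneg h, ← Complex.ofReal_mul]
      congr 2
      field_simp
    · obtain ⟨A, h1, h2, h3⟩ := exists_diracSymbol_eq_neg_norm
        (EuclideanSpace.single (0 : Fin 3) (l / (ħ * c)) : Space)
      refine ⟨EuclideanSpace.single (0 : Fin 3) (l / (ħ * c)), A, h1, h2, ?_⟩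
      rw [h3, hk, smul_smul, abs_of_neg h, ← Complex.ofReal_neg, ← Complex.ofReal_mul]
      congr 2
      field_simp
  let P : TestFields →ₗ[ℂ] TestFields := mapT TZero.starProjection
  let H := hamiltonianT ħ c
  let ξ : TestFields :=
    smulField (shrinkingBump 0).contDiff (shrinkingBump 0).hasCompactSupport A
  have hξ : ξ ∈ fieldsIn TZero := fun x => TZero.smul_mem _ hA
  have hPξ : P ξ = ξ := mem_fieldsIn_iff_mapT.1 hξ
  have hξ0 : ξ ≠ 0 := by
    intro h
    have h1 := congrArg (fun φ : TestFields => φ.1 0) h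
    have h2 : shrinkingBump 0 (0 : Space) = 1 :=
      (shrinkingBump 0).one_of_mem_closedBall (Metric.mem_closedBall_self (shrinkingBump 0).rIn_pos.le)
    have h3 : ((shrinkingBump 0 (0 : Space) : ℝ) : ℂ) • A = 0 := h1
    rw [h2] at h3
    simp [hA0] at h3
  have hDξ : ((ħ * c : ℝ) : ℂ) • mapT (diracSymbol k) ξ = (l : ℂ) • ξ := by
    refine Subtype.ext (funext fun x => ?_)
    change ((ħ * c : ℝ) : ℂ) • diracSymbol k ((shrinkingBump 0 x : ℂ) • A) =
      (l : ℂ) • ((shrinkingBump 0 x : ℂ) • A)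
    rw [map_smul, smul_comm, hAk, smul_comm]
  let χ := P (H ξ)
  have hPχ : P χ = χ := mem_fieldsIn_iff_mapT.1 fun x => Submodule.starProjection_apply_mem _ _
  let ψ₁ := P (((ħ * c : ℝ) : ℂ) • mapT (diracSymbol k) χ)
  let ψ₂ := P (H χ)
  -- The packet `e^{ik·x} ξ(εx)` need not be transversal, but its image under the compression is,
  -- and differs from `l` times the packet only by a term of order `ε`. That image is the trial
  -- field.
  have e1 : ∀ {ε : ℝ} (hε : ε ≠ 0), compressedT TZero ħ c (modulate k hε ξ) =
      modulate k hε ((l : ℂ) • ξ + (ε : ℂ) • χ) := by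
    intro ε hε
    change P (H (P (modulate k hε ξ))) = _
    rw [mapT_modulate, hPξ, hamiltonianT_modulate, mapT_modulate, hDξ, map_add, map_smul, map_smul,
      hPξ, add_comm]
  -- The `ε`-free terms, and the two terms `l ε χ`, cancel, so the whole error carries a factor `ε`.
  have e2 : ∀ {ε : ℝ} (hε : ε ≠ 0), compressedT TZero ħ c
      (modulate k hε ((l : ℂ) • ξ + (ε : ℂ) • χ)) -
        (l : ℂ) • modulate k hε ((l : ℂ) • ξ + (ε : ℂ) • χ) =
      (ε : ℂ) • modulate k hε (ψ₁ + (ε : ℂ) • ψ₂) := by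
    intro ε hε
    change P (H (P (modulate k hε _))) - _ = _
    have hP : P ((l : ℂ) • ξ + (ε : ℂ) • χ) = (l : ℂ) • ξ + (ε : ℂ) • χ := by
      rw [map_add, map_smul, map_smul, hPξ, hPχ]
    have h1 : P ((ε : ℂ) • H ((l : ℂ) • ξ + (ε : ℂ) • χ) +
        ((ħ * c : ℝ) : ℂ) • mapT (diracSymbol k) ((l : ℂ) • ξ + (ε : ℂ) • χ)) =
        (l : ℂ) • ((l : ℂ) • ξ + (ε : ℂ) • χ) + (ε : ℂ) • (ψ₁ + (ε : ℂ) • ψ₂) := by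
      have h2 : ((ħ * c : ℝ) : ℂ) • mapT (diracSymbol k) ((l : ℂ) • ξ + (ε : ℂ) • χ) =
          (l : ℂ) • (l : ℂ) • ξ + (ε : ℂ) • ((ħ * c : ℝ) : ℂ) • mapT (diracSymbol k) χ := by
        rw [map_add, map_smul, map_smul, smul_add, smul_comm _ (l : ℂ), hDξ,
          smul_comm _ (ε : ℂ)]
      rw [h2]
      simp only [map_add, map_smul, hPξ, ψ₁, ψ₂, χ]
      module
    rw [mapT_modulate, hP, hamiltonianT_modulate, mapT_modulate,
      ← map_smul (modulate k hε), ← map_sub, ← map_smul (modulate k hε)]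
    congr 1
    rw [sub_eq_iff_eq_add']
    exact h1
  -- As `ε → 0` the left side tends to `0` and the right to `δ ‖l ξ‖`, which is positive only
  -- because `l ≠ 0`.
  have hlim : ∀ᶠ ε : ℝ in 𝓝[>] 0, |ε| * ‖toL2 ψ₁ + (ε : ℂ) • toL2 ψ₂‖ <
      δ * ‖(l : ℂ) • toL2 ξ + (ε : ℂ) • toL2 χ‖ := by
    refine Filter.Eventually.filter_mono nhdsWithin_le_nhds ?_
    have c1 : Continuous fun ε : ℝ => |ε| * ‖toL2 ψ₁ + (ε : ℂ) • toL2 ψ₂‖ := by fun_prop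
    have c2 : Continuous fun ε : ℝ => δ * ‖(l : ℂ) • toL2 ξ + (ε : ℂ) • toL2 χ‖ := by fun_prop
    refine c1.continuousAt.eventually_lt c2.continuousAt ?_
    have : toL2 ξ ≠ 0 := fun h => hξ0 (toL2_injective (h.trans (map_zero _).symm))
    simp only [abs_zero, zero_mul, Complex.ofReal_zero, zero_smul, add_zero, norm_smul,
      Complex.norm_real]
    have h1 : 0 < ‖toL2 ξ‖ := norm_pos_iff.2 this
    have h2 : 0 < ‖l‖ := norm_pos_iff.2 hl
    positivity
  obtain ⟨ε, h1, h2⟩ := (hlim.and self_mem_nhdsWithin).exists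
  have hε : ε ≠ 0 := (show (0 : ℝ) < ε from h2).ne'
  obtain ⟨C, hC, hCn⟩ := norm_toL2_modulate k hε
  have hmem : modulate k hε ((l : ℂ) • ξ + (ε : ℂ) • χ) ∈ TransversalFields ħ c := by
    rw [← e1 hε]
    exact compressedT_mem_transversalFields ħ c _
  refine ⟨_, hmem, ?_⟩
  rw [← compressedT_eq_of_mem_transversalFields hmem, e2 hε, map_smul, norm_smul, hCn, hCn,
    map_add, map_add, map_smul, map_smul, map_smul, Complex.norm_real, Real.norm_eq_abs]
  nlinarith

end PhotonHamiltonian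

namespace PhotonHamiltonian

open scoped Topology

/-! ### Reality of the generalized energies -/

theorem norm_toL2_sq (φ : TestFields) : ‖toL2 φ‖ ^ 2 = ∫ x, ‖φ.1 x‖ ^ 2 := by
  have h1 := inner_toL2 φ φ
  have h2 : ∀ x, ((toMat (φ.1 x)).conjTranspose * toMat (φ.1 x)).trace =
      ((‖φ.1 x‖ ^ 2 : ℝ) : ℂ) := by
    intro x
    rw [← inner_def, inner_self_eq_norm_sq_to_K]
    push_cast
    rfl
  simp only [h2] at h1
  rw [integral_complex_ofReal, inner_self_eq_norm_sq_to_K] at h1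
  simp only [Complex.coe_algebraMap] at h1
  exact_mod_cast h1

theorem partialD_real_smul (j : Fin 3) {f : Space → ℝ} {φ : Space → BiSpinor} {x : Space}
    (hf : DifferentiableAt ℝ f x) (hφ : DifferentiableAt ℝ φ x) :
    partialD j (fun x => (f x : ℂ) • φ x) x =
      (f x : ℂ) • partialD j φ x + ((fderiv ℝ f x (EuclideanSpace.single j 1) : ℝ) : ℂ) • φ x := by
  have h1 : (fun x => (f x : ℂ) • φ x) = f • φ := funext fun x => Complex.coe_smul _ _
  simp only [partialD, h1]
  rw [(hf.hasFDerivAt.smul hφ.hasFDerivAt).fderiv, Complex.coe_smul, Complex.coe_smul]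
  rfl

theorem hamiltonian_real_smul (ħ c : ℝ) {f : Space → ℝ} {φ : Space → BiSpinor} {x : Space}
    (hf : DifferentiableAt ℝ f x) (hφ : DifferentiableAt ℝ φ x) :
    hamiltonian ħ c (fun x => (f x : ℂ) • φ x) x = (f x : ℂ) • hamiltonian ħ c φ x +
      (-(Complex.I * ħ * c)) • ∑ j, ((fderiv ℝ f x (EuclideanSpace.single j 1) : ℝ) : ℂ) •
        leftMul (alpha j) (φ x) := by
  simp only [hamiltonian, partialD_real_smul _ hf hφ, map_add, map_smul, Finset.sum_add_distrib,
    ← Finset.smul_sum, smul_add]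
  rw [smul_comm]

/-- A bound for the commutator of `H` with a scalar function. -/
theorem exists_norm_commutator_le (ħ c : ℝ) : ∃ K : ℝ, 0 ≤ K ∧
    ∀ (g : Space →L[ℝ] ℝ) (A : BiSpinor),
      ‖(-(Complex.I * ħ * c)) • ∑ j, ((g (EuclideanSpace.single j 1) : ℝ) : ℂ) •
        leftMul (alpha j) A‖ ≤ K * ‖g‖ * ‖A‖ := by
  refine ⟨‖-(Complex.I * (ħ : ℂ) * c)‖ * ∑ j, ‖leftMul (alpha j)‖, by positivity, fun g A => ?_⟩
  have h1 : ∀ j, ‖((g (EuclideanSpace.single j 1) : ℝ) : ℂ) • leftMul (alpha j) A‖ ≤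
      ‖leftMul (alpha j)‖ * (‖g‖ * ‖A‖) := by
    intro j
    have h2 : ‖g (EuclideanSpace.single j 1)‖ ≤ ‖g‖ := by
      simpa using g.le_opNorm (EuclideanSpace.single j (1 : ℝ))
    rw [norm_smul, Complex.norm_real]
    calc ‖g (EuclideanSpace.single j 1)‖ * ‖leftMul (alpha j) A‖
        ≤ ‖g‖ * (‖leftMul (alpha j)‖ * ‖A‖) :=
          mul_le_mul h2 ((leftMul (alpha j)).le_opNorm A) (norm_nonneg _) (norm_nonneg _)
      _ = _ := by ring
  have h3 : ‖∑ j, ((g (EuclideanSpace.single j 1) : ℝ) : ℂ) • leftMul (alpha j) A‖ ≤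
      (∑ j, ‖leftMul (alpha j)‖) * (‖g‖ * ‖A‖) := by
    rw [Finset.sum_mul]
    exact norm_sum_le_of_le _ fun j _ => h1 j
  calc _ = ‖-(Complex.I * (ħ : ℂ) * c)‖ *
        ‖∑ j, ((g (EuclideanSpace.single j 1) : ℝ) : ℂ) • leftMul (alpha j) A‖ := norm_smul _ _
    _ ≤ ‖-(Complex.I * (ħ : ℂ) * c)‖ * ((∑ j, ‖leftMul (alpha j)‖) * (‖g‖ * ‖A‖)) := by gcongr
    _ = _ := by ring

theorem abs_im_mul_norm_toL2_le (ħ c : ℝ) (E : ℂ) (ψ : TestFields) :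
    |E.im| * ‖toL2 ψ‖ ≤ ‖toL2 (hamiltonianT ħ c ψ - E • ψ)‖ := by
  rw [map_sub, map_smul]
  exact abs_im_mul_norm_le_norm_sub_smul
    (im_inner_eq_zero_of_symm (inner_hamiltonianT_left ħ c ψ ψ)) E

/-- Smooth cut-off functions with controlled gradient. -/
theorem exists_cutoff : ∃ M : ℝ, 0 ≤ M ∧ ∀ r : ℝ, 0 < r → ∃ f : Space → ℝ,
    ContDiff ℝ ∞ f ∧ HasCompactSupport f ∧ (∀ x ∈ Metric.closedBall 0 r, f x = 1) ∧
      (∀ x, ‖fderiv ℝ f x‖ ≤ M / r) ∧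
      ∀ x, x ∉ Metric.closedBall 0 (2 * r) → fderiv ℝ f x = 0 := by
  let b : ContDiffBump (0 : Space) := ⟨1, 2, one_pos, one_lt_two⟩
  have hb : ContDiff ℝ ∞ b := b.contDiff
  have hbd : Differentiable ℝ b := hb.differentiable (by simp)
  obtain ⟨M, hM⟩ : ∃ M, ∀ x, ‖fderiv ℝ b x‖ ≤ M :=
    (b.hasCompactSupport.fderiv (𝕜 := ℝ)).exists_bound_of_continuous
      (hb.continuous_fderiv (by simp))
  refine ⟨M, (norm_nonneg _).trans (hM 0), fun r hr => ?_⟩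
  have hr' : r⁻¹ ≠ 0 := inv_ne_zero hr.ne'
  have hfderiv : ∀ x, fderiv ℝ (fun x => b (r⁻¹ • x)) x = r⁻¹ • fderiv ℝ b (r⁻¹ • x) := by
    intro x
    have h1 : HasFDerivAt (fun x : Space => r⁻¹ • x) (r⁻¹ • ContinuousLinearMap.id ℝ Space) x :=
      (hasFDerivAt_id x).const_smul r⁻¹
    refine (((hbd (r⁻¹ • x)).hasFDerivAt.comp x h1).fderiv).trans ?_
    ext v
    simp
  refine ⟨fun x => b (r⁻¹ • x), hb.comp (contDiff_const_smul r⁻¹),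
    b.hasCompactSupport.comp_homeomorph (Homeomorph.smulOfNeZero r⁻¹ hr'), ?_, ?_, ?_⟩
  · intro x hx
    refine b.one_of_mem_closedBall ?_
    rw [mem_closedBall_zero_iff, norm_smul, Real.norm_of_nonneg (inv_nonneg.2 hr.le),
      inv_mul_le_iff₀ hr]
    rw [mem_closedBall_zero_iff] at hx
    linarith [show b.rIn = 1 from rfl]
  · intro x
    rw [hfderiv, norm_smul, Real.norm_of_nonneg (inv_nonneg.2 hr.le), div_eq_inv_mul]
    exact mul_le_mul_of_nonneg_left (hM _) (inv_nonneg.2 hr.le)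
  · intro x hx
    rw [hfderiv, image_eq_zero_of_notMem_tsupport (f := fderiv ℝ b), smul_zero]
    intro h'
    have h1 := tsupport_fderiv_subset ℝ h'
    rw [b.tsupport_eq, mem_closedBall_zero_iff, norm_smul,
      Real.norm_of_nonneg (inv_nonneg.2 hr.le), inv_mul_le_iff₀ hr] at h1
    refine hx ?_
    rw [mem_closedBall_zero_iff]
    linarith [show b.rOut = 2 from rfl]

theorem setIntegral_le_norm_toL2_sq (ψ : TestFields) {s : Set Space} (hs : MeasurableSet s)
    {g : Space → ℝ} (hg : IntegrableOn g s) (h : ∀ x ∈ s, g x ≤ ‖ψ.1 x‖ ^ 2) :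
    ∫ x in s, g x ≤ ‖toL2 ψ‖ ^ 2 := by
  have hψ : Integrable fun x => ‖ψ.1 x‖ ^ 2 := (testFields_memLp ψ).norm.integrable_sq
  rw [norm_toL2_sq]
  exact (setIntegral_mono_on hg hψ.integrableOn hs h).trans
    (setIntegral_le_integral hψ (Filter.Eventually.of_forall fun x => sq_nonneg _))

theorem norm_toL2_sq_le_setIntegral (ψ : TestFields) {s : Set Space} (hs : MeasurableSet s)
    {g : Space → ℝ} (hg : IntegrableOn g s) (h : ∀ x ∈ s, ‖ψ.1 x‖ ^ 2 ≤ g x)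
    (h0 : ∀ x, x ∉ s → ψ.1 x = 0) : ‖toL2 ψ‖ ^ 2 ≤ ∫ x in s, g x := by
  have hψ : Integrable fun x => ‖ψ.1 x‖ ^ 2 := (testFields_memLp ψ).norm.integrable_sq
  rw [norm_toL2_sq, ← setIntegral_eq_integral_of_forall_compl_eq_zero (s := s)
    fun x hx => by rw [h0 x hx, norm_zero, zero_pow two_ne_zero]]
  exact setIntegral_mono_on hψ.integrableOn hg hs h

/-- The Caccioppoli inequality for eigenfunctions with a non-real eigenvalue. -/
theorem exists_caccioppoli {ħ c : ℝ} {E : ℂ} (hE : E.im ≠ 0) {φ : Space → BiSpinor}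
    (hφ : ContDiff ℝ ∞ φ) (h : hamiltonian ħ c φ = E • φ) :
    ∃ C : ℝ, 0 ≤ C ∧ ∀ r : ℝ, 0 < r →
      ∫ x in Metric.closedBall 0 r, ‖φ x‖ ^ 2 ≤
        C / r ^ 2 * ∫ x in Metric.closedBall 0 (2 * r), ‖φ x‖ ^ 2 := by
  obtain ⟨K, hK0, hK⟩ := exists_norm_commutator_le ħ c
  obtain ⟨M, hM0, hM⟩ := exists_cutoff
  have hφd : Differentiable ℝ φ := hφ.differentiable (by simp)
  have hint : ∀ r : ℝ, IntegrableOn (fun x => ‖φ x‖ ^ 2) (Metric.closedBall 0 r) := fun r =>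
    ((hφ.continuous.norm).pow 2).continuousOn.integrableOn_compact (isCompact_closedBall 0 r)
  refine ⟨(K * M) ^ 2 / E.im ^ 2, by positivity, fun r hr => ?_⟩
  obtain ⟨f, hf, hfc, hf1, hfM, hf0⟩ := hM r hr
  have hfd : Differentiable ℝ f := hf.differentiable (by simp)
  obtain ⟨ψ, hψ⟩ : ∃ ψ : TestFields, ψ.1 = fun x => (f x : ℂ) • φ x :=
    ⟨⟨fun x => (f x : ℂ) • φ x, (Complex.ofRealCLM.contDiff.comp hf).smul hφ,
      (hfc.comp_left (g := ((↑) : ℝ → ℂ)) rfl).smul_right⟩, rfl⟩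
  obtain ⟨W, hW⟩ : ∃ W : TestFields, W = hamiltonianT ħ c ψ - E • ψ := ⟨_, rfl⟩
  -- With `ψ = f φ`, the eigenvalue equation reduces `(H - E) ψ` to the commutator of `H` with `f`:
  -- it vanishes outside the ball of radius `2r` and is of size `1 / r`. Symmetry of `H` bounds `|Im
  -- E| ‖ψ‖` by its norm.
  have hWx : ∀ x, W.1 x = (-(Complex.I * ħ * c)) • ∑ j,
      ((fderiv ℝ f x (EuclideanSpace.single j 1) : ℝ) : ℂ) • leftMul (alpha j) (φ x) := by
    intro x
    have h1 : W.1 x = hamiltonian ħ c ψ.1 x - E • ψ.1 x := by rw [hW, ← hamiltonianT_coe]; rfl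
    rw [h1, hψ, hamiltonian_real_smul ħ c (hfd x) (hφd x), h, Pi.smul_apply, smul_comm E]
    abel
  have h1 : ∫ x in Metric.closedBall 0 r, ‖φ x‖ ^ 2 ≤ ‖toL2 ψ‖ ^ 2 := by
    refine setIntegral_le_norm_toL2_sq ψ Metric.isClosed_closedBall.measurableSet (hint r)
      fun x hx => ?_
    simp only [hψ, hf1 x hx, Complex.ofReal_one, one_smul, le_refl]
  have h2 : ‖toL2 W‖ ^ 2 ≤
      (K * (M / r)) ^ 2 * ∫ x in Metric.closedBall 0 (2 * r), ‖φ x‖ ^ 2 := by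
    rw [← integral_const_mul]
    refine norm_toL2_sq_le_setIntegral W Metric.isClosed_closedBall.measurableSet
      (Integrable.const_mul (hint (2 * r)) _) (fun x _ => ?_) fun x hx => ?_
    · rw [← mul_pow, hWx]
      refine pow_le_pow_left₀ (norm_nonneg _) ((hK _ _).trans ?_) 2
      exact mul_le_mul_of_nonneg_right (mul_le_mul_of_nonneg_left (hfM x) hK0) (norm_nonneg _)
    · rw [hWx, hf0 x hx]
      simp
  have h3 : |E.im| * ‖toL2 ψ‖ ≤ ‖toL2 W‖ := hW ▸ abs_im_mul_norm_toL2_le ħ c E ψ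
  have h4 : E.im ^ 2 * ‖toL2 ψ‖ ^ 2 ≤ ‖toL2 W‖ ^ 2 := by
    rw [← sq_abs E.im, ← mul_pow]
    exact pow_le_pow_left₀ (by positivity) h3 2
  have hE2 : 0 < E.im ^ 2 := by positivity
  have h5 : ‖toL2 ψ‖ ^ 2 ≤ ((K * (M / r)) ^ 2 *
      ∫ x in Metric.closedBall 0 (2 * r), ‖φ x‖ ^ 2) / E.im ^ 2 := by
    rw [le_div_iff₀ hE2, mul_comm]
    exact h4.trans h2
  refine h1.trans (h5.trans (le_of_eq ?_))
  field_simp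

/-- Bounded eigenfunctions have real eigenvalues. -/
theorem im_eq_zero_of_bounded_eigenfunction {ħ c : ℝ} {E : ℂ} {φ : Space → BiSpinor}
    (hφ : ContDiff ℝ ∞ φ) {B : ℝ} (hB : ∀ x, ‖φ x‖ ≤ B) (hne : φ ≠ 0)
    (h : hamiltonian ħ c φ = E • φ) : E.im = 0 := by
  by_contra hE
  obtain ⟨C, hC0, hC⟩ := exists_caccioppoli hE hφ h
  set J : ℝ → ℝ := fun r => ∫ x in Metric.closedBall 0 r, ‖φ x‖ ^ 2 with hJ
  have hφc : Continuous fun x => ‖φ x‖ ^ 2 := (hφ.continuous.norm).pow 2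
  have hint : ∀ r : ℝ, IntegrableOn (fun x => ‖φ x‖ ^ 2) (Metric.closedBall 0 r) := fun r =>
    hφc.continuousOn.integrableOn_compact (isCompact_closedBall 0 r)
  have hJmono : ∀ {r s : ℝ}, r ≤ s → J r ≤ J s := fun {r s} hrs =>
    setIntegral_mono_set (hint s) (Filter.Eventually.of_forall fun x => sq_nonneg _)
      (Metric.closedBall_subset_closedBall hrs).eventuallyLE
  obtain ⟨M, hM0, hM⟩ : ∃ M : ℝ, 0 ≤ M ∧ ∀ r : ℝ, 0 < r → J r ≤ M * r ^ 3 := by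
    refine ⟨B ^ 2 * (volume : Measure Space).real (Metric.closedBall 0 1), by positivity,
      fun r hr => ?_⟩
    have h1 : J r ≤ ∫ _ in Metric.closedBall (0 : Space) r, B ^ 2 :=
      setIntegral_mono (hint r) (by
        rw [integrableOn_const_iff]
        right
        exact measure_closedBall_lt_top) fun x =>
          pow_le_pow_left₀ (norm_nonneg _) (hB x) 2
    rw [setIntegral_const, smul_eq_mul, Measure.real,
      Measure.addHaar_closedBall' _ _ hr.le, ENNReal.toReal_mul, ENNReal.toReal_ofReal (by positivity),
      finrank_euclideanSpace, Fintype.card_fin] at h1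
    rw [Measure.real]
    linarith
  -- One use of the inequality gains `r⁻²`, not enough against the volume `r³`; two gain `r⁻⁴` and
  -- leave `1 / r`.
  have hdecay : ∀ r : ℝ, 0 < r → J r ≤ 16 * C ^ 2 * M / r := by
    intro r hr
    have h1 := hC r hr
    have h2 := hC (2 * r) (by positivity)
    have h3 := hM (2 * (2 * r)) (by positivity)
    calc J r ≤ C / r ^ 2 * J (2 * r) := h1
      _ ≤ C / r ^ 2 * (C / (2 * r) ^ 2 * J (2 * (2 * r))) := by gcongr
      _ ≤ C / r ^ 2 * (C / (2 * r) ^ 2 * (M * (2 * (2 * r)) ^ 3)) := by gcongr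
      _ = 16 * C ^ 2 * M / r := by field_simp; ring
  obtain ⟨x₀, hx₀⟩ : ∃ x, φ x ≠ 0 := Function.ne_iff.1 hne
  have hpos : 0 < J (‖x₀‖ + 1) := by
    rw [hJ]
    have h1 : IsOpen (Metric.ball (0 : Space) (‖x₀‖ + 1) ∩ {x | ‖φ x‖ ^ 2 ≠ 0}) :=
      Metric.isOpen_ball.inter (isOpen_ne_fun hφc continuous_const)
    refine (setIntegral_pos_iff_support_of_nonneg_ae
      (Filter.Eventually.of_forall fun x => sq_nonneg _) (hint _)).2 ?_
    refine (h1.measure_pos volume ⟨x₀, ?_, ?_⟩).trans_le (measure_mono ?_)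
    · rw [mem_ball_zero_iff]; linarith
    · exact pow_ne_zero 2 (norm_ne_zero_iff.2 hx₀)
    · rintro x ⟨hx1, hx2⟩
      exact ⟨hx2, Metric.ball_subset_closedBall hx1⟩
  -- The first entry keeps `x₀` well inside the ball; the second pushes the decay bound strictly
  -- below the positive integral around `x₀`.
  set r := max (‖x₀‖ + 1) (16 * C ^ 2 * M / J (‖x₀‖ + 1) + 1) with hr
  have hr0 : 0 < r := lt_of_lt_of_le (by positivity) (le_max_left _ _)
  have h1 : J (‖x₀‖ + 1) ≤ 16 * C ^ 2 * M / r := (hJmono (le_max_left _ _)).trans (hdecay r hr0)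
  rw [le_div_iff₀ hr0] at h1
  have h2 : 16 * C ^ 2 * M / J (‖x₀‖ + 1) < r := (lt_add_one _).trans_le (le_max_right _ _)
  rw [div_lt_iff₀ hpos] at h2
  linarith

end PhotonHamiltonian

namespace PhotonHamiltonian

/-! ### Plane waves -/

theorem planeWave_eq (k : Space) (A : BiSpinor) : planeWave k A = fun x => phase k x • A := rfl

theorem planeWave_ne_zero (k : Space) {A : BiSpinor} (hA : A ≠ 0) : planeWave k A ≠ 0 := by
  intro h
  exact smul_ne_zero (phase_ne_zero k 0) hA (congrFun h 0)

theorem contDiff_planeWave (k : Space) (A : BiSpinor) : ContDiff ℝ ∞ (planeWave k A) :=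
  (phase_contDiff k).smul contDiff_const

theorem isGeneralizedState_planeWave (k : Space) {A : BiSpinor} (hA : A ∈ TZero) (h : A ≠ 0) :
    IsGeneralizedState (planeWave k A) :=
  ⟨contDiff_planeWave k A, ⟨‖A‖, fun x => by rw [planeWave_eq, norm_smul, norm_phase, one_mul]⟩,
    fun x => TZero.smul_mem (phase k x) hA, planeWave_ne_zero k h⟩

theorem hamiltonian_planeWave (ħ c : ℝ) (k : Space) (A : BiSpinor) :
    hamiltonian ħ c (planeWave k A) =
      fun x => phase k x • ((ħ * c : ℝ) : ℂ) • diracSymbol k A := by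
  funext x
  rw [planeWave_eq, hamiltonian_phase_smul ħ c k (differentiableAt_const A)]
  have : hamiltonian ħ c (fun _ => A) x = 0 := by simp [hamiltonian, partialD]
  rw [this, zero_add]

theorem momentum_planeWave (ħ : ℝ) (j : Fin 3) (k : Space) (A : BiSpinor) :
    momentum ħ j (planeWave k A) = ((ħ * k j : ℝ) : ℂ) • planeWave k A := by
  funext x
  have hI := Complex.I_sq
  have h0 : partialD j (fun _ => A) x = 0 := by simp [partialD]
  rw [planeWave_eq, momentum, partialD_phase_smul k j (differentiableAt_const A), h0, zero_add,
    Pi.smul_apply, smul_comm (phase k x), smul_smul]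
  congr 1
  push_cast
  linear_combination (-(ħ : ℂ) * k j) * hI

theorem hamiltonian_planeWave_eq_iff (ħ c : ℝ) (k : Space) (A : BiSpinor) (E : ℂ) :
    hamiltonian ħ c (planeWave k A) = E • planeWave k A ↔
      ((ħ * c : ℝ) : ℂ) • diracSymbol k A = E • A := by
  rw [hamiltonian_planeWave]
  constructor
  · intro h
    have h1 : phase k 0 • ((ħ * c : ℝ) : ℂ) • diracSymbol k A = E • phase k 0 • A := congrFun h 0
    rw [smul_comm E] at h1
    exact smul_right_injective _ (phase_ne_zero k 0) h1
  · intro h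
    funext x
    rw [h, Pi.smul_apply, planeWave_eq, smul_comm E]

/-- Applying `ħc α·k` twice forces `E² = (ħc‖k‖)²`; the helicity vectors realize both roots. -/
theorem exists_planeWave_eigen_iff (ħ c : ℝ) (k : Space) (E : ℂ) :
    (∃ A ∈ TZero, A ≠ 0 ∧ hamiltonian ħ c (planeWave k A) = E • planeWave k A) ↔
      (E = ((ħ * c * ‖k‖ : ℝ) : ℂ) ∨ E = ((-(ħ * c * ‖k‖) : ℝ) : ℂ)) := by
  simp only [hamiltonian_planeWave_eq_iff]
  constructor
  · rintro ⟨A, -, h0, h⟩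
    have h1 : ((ħ * c : ℝ) : ℂ) • diracSymbol k (((ħ * c : ℝ) : ℂ) • diracSymbol k A) =
        E • E • A := by
      rw [h, map_smul, smul_comm, h]
    rw [map_smul, diracSymbol_diracSymbol, smul_smul, smul_smul, smul_smul] at h1
    have h2 := smul_left_injective ℂ h0 h1
    have h3 : (E - ((ħ * c * ‖k‖ : ℝ) : ℂ)) * (E - ((-(ħ * c * ‖k‖) : ℝ) : ℂ)) = 0 := by
      push_cast at h2 ⊢
      linear_combination -h2
    rcases mul_eq_zero.1 h3 with h4 | h4
    · exact Or.inl (sub_eq_zero.1 h4)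
    · exact Or.inr (sub_eq_zero.1 h4)
  · rintro (rfl | rfl)
    · obtain ⟨A, h1, h2, h3⟩ := exists_diracSymbol_eq_norm k
      refine ⟨A, h1, h2, ?_⟩
      rw [h3, smul_smul]
      push_cast
      rfl
    · obtain ⟨A, h1, h2, h3⟩ := exists_diracSymbol_eq_neg_norm k
      refine ⟨A, h1, h2, ?_⟩
      rw [h3, smul_smul]
      push_cast
      rw [mul_neg]

/-- The right side just says that `E` is real, since a wave vector along an axis may have any
length. Thus only reality needs an argument about general bounded fields. -/
theorem exists_generalizedState_eigen_iff {ħ c : ℝ} (hħ : 0 < ħ) (hc : 0 < c) (E : ℂ) :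
    (∃ φ, IsGeneralizedState φ ∧ hamiltonian ħ c φ = E • φ) ↔
      ∃ k : Space, E = ((ħ * c * ‖k‖ : ℝ) : ℂ) ∨ E = ((-(ħ * c * ‖k‖) : ℝ) : ℂ) := by
  constructor
  · rintro ⟨φ, ⟨h1, ⟨B, hB⟩, -, h0⟩, h⟩
    have him := im_eq_zero_of_bounded_eigenfunction h1 hB h0 h
    have hE : E = ((E.re : ℝ) : ℂ) := Complex.ext rfl him
    have hne : ħ * c ≠ 0 := (mul_pos hħ hc).ne'
    refine ⟨EuclideanSpace.single 0 (E.re / (ħ * c)), ?_⟩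
    rw [PiLp.norm_single, Real.norm_eq_abs, abs_div, abs_of_pos (mul_pos hħ hc),
      mul_div_cancel₀ _ hne, hE, Complex.ofReal_re]
    rcases abs_choice E.re with h2 | h2
    · exact Or.inl (by rw [h2])
    · exact Or.inr (by rw [h2, neg_neg])
  · rintro ⟨k, hk⟩
    obtain ⟨A, h1, h2, h3⟩ := (exists_planeWave_eigen_iff ħ c k E).2 hk
    exact ⟨planeWave k A, isGeneralizedState_planeWave k h1 h2, h3⟩

/-! ### Commutation of differential expressions -/

theorem contDiff_partialD (j : Fin 3) {φ : Space → BiSpinor} (hφ : ContDiff ℝ ∞ φ) :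
    ContDiff ℝ ∞ (partialD j φ) :=
  (hφ.fderiv_right (m := ∞) (by simp)).clm_apply contDiff_const

theorem partialD_comm (i j : Fin 3) {φ : Space → BiSpinor} (hφ : ContDiff ℝ ∞ φ) :
    partialD i (partialD j φ) = partialD j (partialD i φ) := by
  have hd : Differentiable ℝ (fderiv ℝ φ) :=
    (hφ.fderiv_right (m := ∞) (by simp)).differentiable (by simp)
  have h : ∀ (i j : Fin 3) (x : Space), partialD i (partialD j φ) x =
      fderiv ℝ (fderiv ℝ φ) x (EuclideanSpace.single i 1) (EuclideanSpace.single j 1) := by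
    intro i j x
    change fderiv ℝ (fun y => fderiv ℝ φ y (EuclideanSpace.single j 1)) x _ = _
    rw [fderiv_clm_apply (hd x) (differentiableAt_const _)]
    simp
  funext x
  rw [h, h]
  exact (hφ.contDiffAt.isSymmSndFDerivAt
    (by rw [minSmoothness_of_isRCLikeNormedField]; exact WithTop.coe_le_coe.2 le_top)).eq _ _

theorem partialD_const_smul (j : Fin 3) (a : ℂ) {φ : Space → BiSpinor}
    (hφ : Differentiable ℝ φ) : partialD j (fun x => a • φ x) = fun x => a • partialD j φ x := by
  funext x
  change fderiv ℝ (fun y => a • φ y) x _ = a • fderiv ℝ φ x _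
  rw [fderiv_fun_const_smul (hφ x)]
  rfl

theorem hamiltonian_const_smul (ħ c : ℝ) (a : ℂ) {φ : Space → BiSpinor}
    (hφ : Differentiable ℝ φ) (x : Space) :
    hamiltonian ħ c (fun x => a • φ x) x = a • hamiltonian ħ c φ x := by
  simp only [hamiltonian, partialD_const_smul _ a hφ, map_smul, ← Finset.smul_sum]
  rw [smul_comm]

theorem hamiltonian_momentum (ħ c : ℝ) (j : Fin 3) {φ : Space → BiSpinor} (hφ : ContDiff ℝ ∞ φ) :
    hamiltonian ħ c (momentum ħ j φ) = momentum ħ j (hamiltonian ħ c φ) := by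
  have hd : ∀ i, Differentiable ℝ (partialD i φ) := fun i =>
    (contDiff_partialD i hφ).differentiable (by simp)
  have h1 : partialD j (hamiltonian ħ c φ) = hamiltonian ħ c (partialD j φ) := by
    have hl : ∀ (i : Fin 3) (x : Space), HasFDerivAt (fun x => leftMul (alpha i) (partialD i φ x))
        (((leftMul (alpha i)).restrictScalars ℝ) ∘L fderiv ℝ (partialD i φ) x) x := fun i x =>
      ((leftMul (alpha i)).restrictScalars ℝ).hasFDerivAt.comp x (hd i x).hasFDerivAt
    have hs : ∀ x, HasFDerivAt (fun x => ∑ i, leftMul (alpha i) (partialD i φ x))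
        (∑ i, ((leftMul (alpha i)).restrictScalars ℝ) ∘L fderiv ℝ (partialD i φ) x) x := fun x =>
      HasFDerivAt.fun_sum fun i _ => hl i x
    have e : hamiltonian ħ c φ = fun x => (-(Complex.I * ħ * c)) •
        ∑ i, leftMul (alpha i) (partialD i φ x) := rfl
    rw [e, partialD_const_smul j _ fun x => (hs x).differentiableAt]
    funext x
    simp only [hamiltonian]
    congr 1
    change fderiv ℝ _ x _ = _
    rw [(hs x).fderiv, sum_apply]
    refine Finset.sum_congr rfl fun i _ => ?_
    rw [partialD_comm i j hφ]
    rfl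
  funext x
  have e : momentum ħ j φ = fun x => (-(Complex.I * ħ)) • partialD j φ x := rfl
  rw [e, hamiltonian_const_smul ħ c _ (hd j), momentum, h1]

/-! ### Time evolution -/

theorem solvesSchrodinger_harmonic_iff {ħ c : ℝ} (freq : ℝ) {φ : Space → BiSpinor}
    (hφ : ContDiff ℝ ∞ φ) : SolvesSchrodinger ħ c (harmonic freq φ) ↔
      hamiltonian ħ c φ = ((ħ * freq : ℝ) : ℂ) • φ := by
  have hφd : Differentiable ℝ φ := hφ.differentiable (by simp)
  have hI := Complex.I_sq
  have hd : ∀ (t : ℝ) (x : Space), HasDerivAt (fun s => harmonic freq φ s x)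
      ((Complex.exp (-(Complex.I * freq * t)) * -(Complex.I * freq)) • φ x) t := by
    intro t x
    have h1 : HasDerivAt (fun s : ℝ => -(Complex.I * freq * (s : ℂ))) (-(Complex.I * freq)) t := by
      simpa using ((Complex.ofRealCLM.hasDerivAt (x := t)).const_mul (Complex.I * freq)).fun_neg
    exact h1.cexp.smul_const (φ x)
  have hH : ∀ (t : ℝ) (x : Space), hamiltonian ħ c (harmonic freq φ t) x =
      Complex.exp (-(Complex.I * freq * t)) • hamiltonian ħ c φ x := fun t x =>
    hamiltonian_const_smul ħ c _ hφd x
  have hc : ∀ (t : ℝ) (x : Space), (Complex.I * ħ) •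
      ((Complex.exp (-(Complex.I * freq * t)) * -(Complex.I * freq)) • φ x) =
      Complex.exp (-(Complex.I * freq * t)) • ((ħ * freq : ℝ) : ℂ) • φ x := by
    intro t x
    rw [smul_smul, smul_smul]
    congr 1
    push_cast
    linear_combination (-(ħ : ℂ) * freq * Complex.exp (-(Complex.I * freq * t))) * hI
  constructor
  · rintro ⟨-, h⟩
    funext x
    obtain ⟨Φ', h1, h2⟩ := h 0 x
    rw [h1.unique (hd 0 x), hc, hH] at h2
    exact (smul_right_injective _ (Complex.exp_ne_zero _) h2).symm
  · intro h
    refine ⟨fun t => (contDiff_const (c := Complex.exp (-(Complex.I * freq * t)))).smul hφ, fun t x => ⟨_, hd t x, ?_⟩⟩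
    rw [hc, hH, h, Pi.smul_apply]

/-! ### Momentum eigenfunctions -/

theorem fderiv_eq_sum_partialD (φ : Space → BiSpinor) (y x : Space) :
    fderiv ℝ φ y x = ∑ j, (x j : ℂ) • partialD j φ y := by
  have h : x = ∑ j, x j • (EuclideanSpace.single j (1 : ℝ) : Space) := by
    ext i
    simp [Fin.sum_univ_three]
    fin_cases i <;> simp
  conv_lhs => rw [h]
  rw [map_sum]
  refine Finset.sum_congr rfl fun j _ => ?_
  rw [map_smul, Complex.coe_smul]
  rfl

/-- Along the ray `t ↦ t x` the equations become `u' = l u` with constant `l`, so `e^{-lt} φ(t x)`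
is constant; compare `t = 1` with `t = 0`. -/
theorem eq_exp_smul_of_momentum_eq {ħ : ℝ} (hħ : ħ ≠ 0) {p : Fin 3 → ℂ} {φ : Space → BiSpinor}
    (hφ : Differentiable ℝ φ) (h : ∀ j, momentum ħ j φ = p j • φ) (x : Space) :
    φ x = Complex.exp (∑ j, x j * (Complex.I * (p j / ħ))) • φ 0 := by
  have hħ' : (ħ : ℂ) ≠ 0 := Complex.ofReal_ne_zero.2 hħ
  have hI := Complex.I_sq
  have hp : ∀ j y, partialD j φ y = (Complex.I * (p j / ħ)) • φ y := by
    intro j y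
    have h1 : (-(Complex.I * ħ)) • partialD j φ y = p j • φ y := congrFun (h j) y
    have h2 : (-(Complex.I * (ħ : ℂ))) * (Complex.I / ħ) = 1 := by
      field_simp
      linear_combination -hI
    calc partialD j φ y = (Complex.I / ħ) • (-(Complex.I * (ħ : ℂ))) • partialD j φ y := by
          rw [smul_smul, mul_comm, h2, one_smul]
      _ = _ := by rw [h1, smul_smul]; congr 1; ring
  set l : ℂ := ∑ j, x j * (Complex.I * (p j / ħ)) with hl
  have hd : ∀ t : ℝ, HasDerivAt (fun t : ℝ => Complex.exp (-(l * t)) • φ (t • x)) 0 t := by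
    intro t
    have h1 : HasDerivAt (fun s : ℝ => -(l * (s : ℂ))) (-l) t := by
      simpa using ((Complex.ofRealCLM.hasDerivAt (x := t)).const_mul l).fun_neg
    have h2 : HasDerivAt (fun s : ℝ => s • x) x t := by
      simpa using (hasDerivAt_id t).smul_const x
    have h3 : HasDerivAt (fun s : ℝ => φ (s • x)) (l • φ (t • x)) t := by
      have h4 := (hφ (t • x)).hasFDerivAt.comp_hasDerivAt t h2
      rw [fderiv_eq_sum_partialD] at h4
      simp only [hp, smul_smul, ← Finset.sum_smul] at h4
      exact h4
    have h5 := h1.cexp.smul h3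
    refine h5.congr_deriv ?_
    rw [smul_smul, ← add_smul]
    ring_nf
    simp
  have hconst := is_const_of_deriv_eq_zero (fun t => (hd t).differentiableAt)
    (fun t => (hd t).deriv) 1 0
  simp only [Complex.ofReal_one, mul_one, one_smul, Complex.ofReal_zero, mul_zero, neg_zero,
    Complex.exp_zero, zero_smul] at hconst
  rw [← hconst, smul_smul, ← Complex.exp_add, add_neg_cancel, Complex.exp_zero, one_smul]

theorem momentum_eigenfunction_iff {ħ : ℝ} (hħ : 0 < ħ) (p : Fin 3 → ℂ) {φ : Space → BiSpinor}
    (hs : IsGeneralizedState φ) : (∀ j, momentum ħ j φ = p j • φ) ↔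
      ∃ k : Space, (∀ j, p j = ((ħ * k j : ℝ) : ℂ)) ∧ ∃ A ∈ TZero, φ = planeWave k A := by
  constructor
  · intro h
    obtain ⟨h1, ⟨B, hB⟩, hT, h0⟩ := hs
    have hexp := eq_exp_smul_of_momentum_eq hħ.ne' (h1.differentiable (by simp)) h
    have hφ0 : 0 < ‖φ 0‖ := by
      refine norm_pos_iff.2 fun h2 => h0 (funext fun x => ?_)
      rw [hexp x, h2, smul_zero, Pi.zero_apply]
    have him : ∀ j, (p j).im = 0 := by
      intro j
      by_contra hne
      -- A non-real `p j` would make `φ` grow exponentially along the `j`-th axis. The test point is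
      -- scaled so that the real part of the exponent is exactly `s`.
      have h2 : ∀ s : ℝ, Real.exp s * ‖φ 0‖ ≤ B := by
        intro s
        have h3 := hB (EuclideanSpace.single j (-(s * ħ / (p j).im)))
        rw [hexp, norm_smul, Complex.norm_exp] at h3
        have h4 : (∑ i, (((EuclideanSpace.single j (-(s * ħ / (p j).im)) : Space) i : ℝ) : ℂ) *
            (Complex.I * (p i / ħ))) =
            ((-(s * ħ / (p j).im) : ℝ) : ℂ) * (Complex.I * (p j / ħ)) := by
          rw [Finset.sum_eq_single j]
          · simp
          · intro i _ hi
            simp [hi]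
          · simp
        have h5 : (((-(s * ħ / (p j).im) : ℝ) : ℂ) * (Complex.I * (p j / ħ))).re = s := by
          rw [Complex.re_ofReal_mul, Complex.I_mul_re, Complex.div_ofReal_im]
          field_simp
        rwa [h4, h5] at h3
      -- At this `s`, the bound `s + 1 ≤ e^s` gives `B + ‖φ 0‖ ≤ B`.
      have h6 := h2 (B / ‖φ 0‖)
      have h7 := Real.add_one_le_exp (B / ‖φ 0‖)
      have h8 : (B / ‖φ 0‖ + 1) * ‖φ 0‖ ≤ B := (mul_le_mul_of_nonneg_right h7 hφ0.le).trans h6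
      rw [add_mul, div_mul_cancel₀ _ hφ0.ne', one_mul] at h8
      linarith
    have hpr : ∀ j, p j = ((p j).re : ℂ) := fun j => Complex.ext rfl (him j)
    refine ⟨WithLp.toLp 2 fun j => (p j).re / ħ, fun j => ?_, φ 0, hT 0, funext fun x => ?_⟩
    · rw [hpr j]
      congr 1
      change (p j).re = ħ * ((p j).re / ħ)
      field_simp
    · rw [hexp x, planeWave]
      congr 2
      rw [PiLp.inner_apply, Complex.ofReal_sum, Finset.mul_sum]
      refine Finset.sum_congr rfl fun j _ => ?_
      rw [hpr j]
      simp
      ring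
  · rintro ⟨k, hk, A, -, rfl⟩ j
    rw [momentum_planeWave, hk]

theorem exists_joint_eigenfunction_iff {ħ c : ℝ} (hħ : 0 < ħ) (E : ℂ) (p : Fin 3 → ℂ) :
    (∃ φ, IsGeneralizedState φ ∧ hamiltonian ħ c φ = E • φ ∧ ∀ j, momentum ħ j φ = p j • φ) ↔
      ∃ k : Space, (∀ j, p j = ((ħ * k j : ℝ) : ℂ)) ∧
        (E = ((ħ * c * ‖k‖ : ℝ) : ℂ) ∨ E = ((-(ħ * c * ‖k‖) : ℝ) : ℂ)) := by
  constructor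
  · rintro ⟨φ, hs, h1, h2⟩
    obtain ⟨k, hk, A, hA, rfl⟩ := (momentum_eigenfunction_iff hħ p hs).1 h2
    refine ⟨k, hk, (exists_planeWave_eigen_iff ħ c k E).1 ⟨A, hA, ?_, h1⟩⟩
    rintro rfl
    refine hs.2.2.2 (funext fun x => ?_)
    exact smul_zero (phase k x)
  · rintro ⟨k, hk, hE⟩
    obtain ⟨A, h1, h2, h3⟩ := (exists_planeWave_eigen_iff ħ c k E).2 hE
    refine ⟨planeWave k A, isGeneralizedState_planeWave k h1 h2, h3, fun j => ?_⟩
    rw [momentum_planeWave, hk]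

theorem exists_harmonic_planeWave_iff {ħ c : ℝ} (hħ : 0 < ħ) (freq : ℝ) (k : Space) :
    (∃ A ∈ TZero, A ≠ 0 ∧ SolvesSchrodinger ħ c (harmonic freq (planeWave k A))) ↔
      freq ^ 2 = c ^ 2 * ‖k‖ ^ 2 := by
  simp only [solvesSchrodinger_harmonic_iff freq (contDiff_planeWave k _)]
  rw [exists_planeWave_eigen_iff, Complex.ofReal_inj, Complex.ofReal_inj, mul_assoc, ← mul_neg,
    mul_right_inj' hħ.ne', mul_right_inj' hħ.ne', ← mul_pow, sq_eq_sq_iff_eq_or_eq_neg]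

/-! ### The three domains -/

theorem integral_trace_hamiltonian_symm (ħ c : ℝ) (φ ζ : TestFields) :
    ∫ x, ((toMat (φ.1 x)).conjTranspose * toMat (hamiltonian ħ c ζ.1 x)).trace =
      ∫ x, ((toMat (hamiltonian ħ c φ.1 x)).conjTranspose * toMat (ζ.1 x)).trace := by
  have h := inner_hamiltonianT_left ħ c φ ζ
  rw [inner_toL2, inner_toL2, hamiltonianT_coe, hamiltonianT_coe] at h
  exact h.symm

theorem transversalFields_le (ħ c : ℝ) : TransversalFields ħ c ≤ TZeroFields := inf_le_left

theorem tZeroFields_le : TZeroFields ≤ BlockDiagFields := fun _ h x => tZero_le_blockDiag (h x)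

theorem hamiltonianT_mem_blockDiagFields (ħ c : ℝ) {φ : TestFields} (hφ : φ ∈ BlockDiagFields) :
    hamiltonianT ħ c φ ∈ BlockDiagFields := by
  refine mem_fieldsIn_iff_ft.2 fun k => ?_
  rw [ft_hamiltonianT]
  exact BlockDiag.smul_mem _ (diracSymbol_mem_blockDiag k (mem_fieldsIn_iff_ft.1 hφ k))

/-- The transversal fields lie in every domain considered, and `H` agrees on them with each
compression, so one family of approximate eigenvectors serves all cases. Any momentum component
would do as partner; index `0` is used. -/
theorem hasSelfAdjointHamiltonian_of_isCommutingPair {ħ c : ℝ} (hħ : 0 < ħ) (hc : 0 < c)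
    {V : Submodule ℂ BiSpinor} (hV : TZero ≤ V) {D : Submodule ℂ TestFields} (hD : D ≤ fieldsIn V)
    (hT : TransversalFields ħ c ≤ D)
    (h : ∀ j, IsCommutingPair D (compressedT V ħ c) (momentumT ħ j)) :
    HasSelfAdjointHamiltonian ħ c D := by
  refine (h 0).spectrum_of_inner_eq (fun φ hφ ψ hψ =>
    inner_hamiltonianT_eq_compressedT ħ c (hD hφ) (hD hψ)) fun l hl δ hδ => ?_
  obtain ⟨φ, hφ, hlt⟩ := exists_approximate_eigenvector hħ hc l hl δ hδ
  refine ⟨φ, hT hφ, ?_⟩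
  rwa [compressedT_apply_of_mem (fun x => hV (hφ.1 x)) fun x => hV (hφ.2 x)]

theorem commutesWithMomentum_of_isCommutingPair {ħ c : ℝ}
    {V : Submodule ℂ BiSpinor} {D : Submodule ℂ TestFields} (hD : D ≤ fieldsIn V)
    (h : ∀ j, IsCommutingPair D (compressedT V ħ c) (momentumT ħ j)) :
    CommutesWithMomentum ħ c D := fun j =>
  ⟨(h j).mapsTo_right, (h j).symm.isEssentiallySelfAdjoint,
    (h j).stronglyCommute_of_inner_eq fun _ hφ _ hψ =>
      inner_hamiltonianT_eq_compressedT ħ c (hD hφ) (hD hψ)⟩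

end PhotonHamiltonian

open PhotonHamiltonian in
theorem mainTheorem8 (ħ c : ℝ) (hħ : 0 < ħ) (hc : 0 < c) :
    -- `H` is symmetric on `C_c^∞(ℝ³; T₀)`
    (∀ φ ∈ TZeroFields, ∀ ζ ∈ TZeroFields,
      ∫ x, ((toMat (φ.1 x)).conjTranspose * toMat (hamiltonian ħ c ζ.1 x)).trace =
        ∫ x, ((toMat (hamiltonian ħ c φ.1 x)).conjTranspose * toMat (ζ.1 x)).trace) ∧
    -- essential self-adjointness and spectrum, in the completion of `C_c^∞(ℝ³; T₀)`
    HasSelfAdjointHamiltonian ħ c TZeroFields ∧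
    -- the same on the transversal fields, which `H` leaves invariant
    ((∀ φ ∈ TransversalFields ħ c, hamiltonianT ħ c φ ∈ TransversalFields ħ c) ∧
      HasSelfAdjointHamiltonian ħ c (TransversalFields ħ c)) ∧
    -- the same on all block-diagonal fields, which `H` leaves invariant
    ((∀ φ ∈ BlockDiagFields, hamiltonianT ħ c φ ∈ BlockDiagFields) ∧
      HasSelfAdjointHamiltonian ħ c BlockDiagFields) ∧
    -- the generalized eigenvalues of `H`
    (∀ E : ℂ, (∃ φ, IsGeneralizedState φ ∧ hamiltonian ħ c φ = E • φ) ↔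
      ∃ k : Space, E = ((ħ * c * ‖k‖ : ℝ) : ℂ) ∨ E = ((-(ħ * c * ‖k‖) : ℝ) : ℂ)) ∧
    -- for every wave vector both signs occur, and no other value
    (∀ (k : Space) (E : ℂ),
      (∃ A ∈ TZero, A ≠ 0 ∧ hamiltonian ħ c (planeWave k A) = E • planeWave k A) ↔
        (E = ((ħ * c * ‖k‖ : ℝ) : ℂ) ∨ E = ((-(ħ * c * ‖k‖) : ℝ) : ℂ))) ∧
    -- `H` commutes with the momentum operator
    (∀ (j : Fin 3) (φ : Space → BiSpinor), ContDiff ℝ ∞ φ →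
      hamiltonian ħ c (momentum ħ j φ) = momentum ħ j (hamiltonian ħ c φ)) ∧
    CommutesWithMomentum ħ c TZeroFields ∧
    CommutesWithMomentum ħ c (TransversalFields ħ c) ∧
    CommutesWithMomentum ħ c BlockDiagFields ∧
    -- `E = ħ freq`: a time-harmonic field of frequency `freq` evolves by the Schrodinger equation
    -- exactly when it has energy `ħ freq`; plane waves obey the dispersion relation
    (∀ (freq : ℝ) (φ : Space → BiSpinor), ContDiff ℝ ∞ φ →
      (SolvesSchrodinger ħ c (harmonic freq φ) ↔
        hamiltonian ħ c φ = ((ħ * freq : ℝ) : ℂ) • φ)) ∧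
    (∀ (freq : ℝ) (k : Space),
      (∃ A ∈ TZero, A ≠ 0 ∧ SolvesSchrodinger ħ c (harmonic freq (planeWave k A))) ↔
        freq ^ 2 = c ^ 2 * ‖k‖ ^ 2) ∧
    -- `p = ħk`: the generalized eigenfunctions of momentum are the plane waves, and the
    -- eigenvalue vector is `ħ` times the wave vector
    (∀ (p : Fin 3 → ℂ) (φ : Space → BiSpinor), IsGeneralizedState φ →
      ((∀ j, momentum ħ j φ = p j • φ) ↔
        ∃ k : Space, (∀ j, p j = ((ħ * k j : ℝ) : ℂ)) ∧ ∃ A ∈ TZero, φ = planeWave k A)) ∧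
    -- joint generalized eigenvalues of energy and momentum
    (∀ (E : ℂ) (p : Fin 3 → ℂ),
      (∃ φ, IsGeneralizedState φ ∧ hamiltonian ħ c φ = E • φ ∧
          ∀ j, momentum ħ j φ = p j • φ) ↔
        ∃ k : Space, (∀ j, p j = ((ħ * k j : ℝ) : ℂ)) ∧
          (E = ((ħ * c * ‖k‖ : ℝ) : ℂ) ∨ E = ((-(ħ * c * ‖k‖) : ℝ) : ℂ))) :=
  have hP := isCommutingPair_transversalFields hħ.ne' hc.ne'
  ⟨fun φ _ ζ _ => integral_trace_hamiltonian_symm ħ c φ ζ,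
    hasSelfAdjointHamiltonian_of_isCommutingPair hħ hc le_rfl le_rfl (transversalFields_le ħ c)
      (isCommutingPair_fieldsIn TZero ħ c),
    ⟨fun _ => hamiltonianT_mem_transversalFields,
      hasSelfAdjointHamiltonian_of_isCommutingPair hħ hc le_rfl (transversalFields_le ħ c) le_rfl
        hP⟩,
    ⟨fun _ => hamiltonianT_mem_blockDiagFields ħ c,
      hasSelfAdjointHamiltonian_of_isCommutingPair hħ hc tZero_le_blockDiag le_rfl
        ((transversalFields_le ħ c).trans tZeroFields_le)
        (isCommutingPair_fieldsIn BlockDiag ħ c)⟩,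
    exists_generalizedState_eigen_iff hħ hc,
    exists_planeWave_eigen_iff ħ c,
    fun j _ => hamiltonian_momentum ħ c j,
    commutesWithMomentum_of_isCommutingPair le_rfl (isCommutingPair_fieldsIn TZero ħ c),
    commutesWithMomentum_of_isCommutingPair (transversalFields_le ħ c) hP,
    commutesWithMomentum_of_isCommutingPair le_rfl (isCommutingPair_fieldsIn BlockDiag ħ c),
    fun freq _ => solvesSchrodinger_harmonic_iff freq,
    exists_harmonic_planeWave_iff hħ,
    fun p _ => momentum_eigenfunction_iff hħ p,
    exists_joint_eigenfunction_iff hħ⟩
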